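/- **Conventions.** A growth function is a continuous nondecreasing map $\Phi$ of $[0,\infty)$ onto itself. Let $\mathscr U$ be the set of convex growth functions $\Phi$, of class $C^1$ on $(0,\infty)$, such that $t\mapsto\Phi(t)/t$ is nondecreasing on $(0,\infty)$ and such that, for some $q\ge 1$ and $C>0$, $\Phi(st)\le C t^q\Phi(s)$ for all $t\ge 1$, $s>0$. Let $\mathscr L$ be the set of concave growth functions $\Phi$, of class $C^1$ on $(0,\infty)$, such that $t\mapsto\Phi(t)/t$ is nonincreasing on $(0,\infty)$ and such that, for some $0<p\le 1$ and $C>0$, $\Phi(st)\le C t^p\Phi(s)$ for all $0<t\le 1$, $s>0$. Elements of $\mathscr L\cup\mathscr U$ are homeomorphisms of $[0,\infty)$; $\Phi^{-1}$ denotes the inverse, and $a_\Phi:=\inf_{t>0}\frac{t\Phi'(t)}{\Phi(t)}$. Let $\mathbb C_+=\{x+iy: y>0\}$. For a bounded interval $I\subset\mathbb R$ of length $|I|>0$ put $Q_I=\{x+iy\in\mathbb C_+: x\in I,\ 0<y<|I|\}$. For $\alpha>-1$, a positive Borel measure $\mu$ on $\mathbb C_+$ is an $(\alpha,\Phi)$-Carleson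 measure if there is $C>0$ with $\mu(Q_I)\le C/\Phi(|I|^{-(2+\alpha)})$ for all such $I$. Finally, with $dV_\alpha(x+iy)=y^\alpha\,dx\,dy$, the Bergman–Orlicz space $A^\Phi_\alpha(\mathbb C_+)$ is the set of analytic functions $F$ on $\mathbb C_+$ with $$\|F\|_{A^\Phi_\alpha}:=\inf\Big\{\lambda>0:\int_{\mathbb C_+}\Phi\big(|F|/\lambda\big)\,dV_\alpha\le 1\Big\}<\infty .$$ **Theorem 2.3.** Let $\alpha>-1$, let $\Phi_1,\Phi_2\in\mathscr L\cup\mathscr U$ and let $\mu$ be a positive Borel measure on $\mathbb C_+$. If $t\mapsto\Phi_2(t)/\Phi_1(t)$ is nondecreasing on $(0,\infty)$, then the following assertions are equivalent. (i) $\mu$ is an $(\alpha,\Phi_2\circ\Phi_1^{-1})$-Carleson measure. (ii) There exist $\rho\in\{1,a_{\Phi_1}\}$ and $C_1>0$ such that for all $z=x+iy\in\mathbb C_+$ $$\int_{\mathbb C_+}\Phi_2\left(\Phi_1^{-1}\Big(\frac1{y^{2+\alpha}}\Big)\frac{y^{(4+2\alpha)/\rho}}{|\omega-\overline z|^{(4+2\alpha)/\rho}}\right)d\mu(\omega)\le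 C_1 .$$ (iii) There exists $C_2>0$ such that for all $F\in A^{\Phi_1}_\alpha(\mathbb C_+)$ with $F\not\equiv0$ $$\int_{\mathbb C_+}\Phi_2\left(\frac{|F(z)|}{\|F\|_{A^{\Phi_1}_\alpha}}\right)d\mu(z)\le C_2 .$$ (iv) There exists $C_3>0$ such that for all $F\in A^{\Phi_1}_\alpha(\mathbb C_+)$ $$\sup_{\lambda>0}\Phi_2(\lambda)\,\mu\big(\{z\in\mathbb C_+:|F(z)|>\lambda\|F\|_{A^{\Phi_1}_\alpha}\}\big)\le C_3 .$$ -/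

import Mathlib

open MeasureTheory Set
open scoped UpperHalfPlane Manifold ENNReal

noncomputable section

namespace BergmanOrlicz

/-- A growth function: a continuous nondecreasing map of `[0, ∞)` onto itself. It is modelled by a
function `Φ : ℝ → ℝ` whose values outside `[0, ∞)` play no role. -/
structure IsGrowth (Φ : ℝ → ℝ) : Prop where
  continuousOn : ContinuousOn Φ (Ici 0)
  monotoneOn : MonotoneOn Φ (Ici 0)
  image_eq : Φ '' Ici 0 = Ici 0

/-- `Φ` is of upper type `q`: `Φ (s t) ≤ C t ^ q Φ s` for all `t ≥ 1` and `s > 0`. -/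
def IsUpperType (q : ℝ) (Φ : ℝ → ℝ) : Prop :=
  ∃ C : ℝ, 0 < C ∧ ∀ t : ℝ, 1 ≤ t → ∀ s : ℝ, 0 < s → Φ (s * t) ≤ C * t ^ q * Φ s

/-- `Φ` is of lower type `p`: `Φ (s t) ≤ C t ^ p Φ s` for all `0 < t ≤ 1` and `s > 0`. -/
def IsLowerType (p : ℝ) (Φ : ℝ → ℝ) : Prop :=
  ∃ C : ℝ, 0 < C ∧ ∀ t : ℝ, 0 < t → t ≤ 1 → ∀ s : ℝ, 0 < s → Φ (s * t) ≤ C * t ^ p * Φ s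

/-- The class `𝓤`: convex growth functions, `C¹` on `(0, ∞)`, of some upper type `q ≥ 1`, with
`t ↦ Φ t / t` nondecreasing on `(0, ∞)`. -/
structure ClassU (Φ : ℝ → ℝ) : Prop where
  growth : IsGrowth Φ
  upperType : ∃ q : ℝ, 1 ≤ q ∧ IsUpperType q Φ
  monotoneOn_div : MonotoneOn (fun t => Φ t / t) (Ioi 0)
  contDiffOn : ContDiffOn ℝ 1 Φ (Ioi 0)
  convexOn : ConvexOn ℝ (Ici 0) Φ

/-- The class `𝓛`: concave growth functions, `C¹` on `(0, ∞)`, of some lower type `0 < p ≤ 1`, with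
`t ↦ Φ t / t` nonincreasing on `(0, ∞)`. -/
structure ClassL (Φ : ℝ → ℝ) : Prop where
  growth : IsGrowth Φ
  lowerType : ∃ p : ℝ, 0 < p ∧ p ≤ 1 ∧ IsLowerType p Φ
  antitoneOn_div : AntitoneOn (fun t => Φ t / t) (Ioi 0)
  contDiffOn : ContDiffOn ℝ 1 Φ (Ioi 0)
  concaveOn : ConcaveOn ℝ (Ici 0) Φ

/-- The inverse `Φ⁻¹ : [0, ∞) → [0, ∞)` of a one-to-one growth function. -/
def inv (Φ : ℝ → ℝ) : ℝ → ℝ := Function.invFunOn Φ (Ici 0)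

/-- The lower index `a_Φ = inf_{t > 0} t Φ'(t) / Φ(t)`. -/
def lowerIndex (Φ : ℝ → ℝ) : ℝ := ⨅ t : Ioi (0 : ℝ), (t : ℝ) * deriv Φ t / Φ t

/-- The Carleson square `Q_I = {x + i y : x ∈ I, 0 < y < |I|}`. -/
def carlesonSquare (I : Set ℝ) : Set ℍ := {z | z.re ∈ I ∧ z.im < volume.real I}

/-- `μ` is an `(s, Φ)`-Carleson measure: `μ (Q_I) ≤ C / Φ (1 / |I| ^ s)` for every interval `I` of
nonzero finite length (open, closed or half-open). -/
def IsSCarleson (s : ℝ) (Φ : ℝ → ℝ) (μ : Measure ℍ) : Prop :=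
  ∃ C : ℝ, 0 < C ∧ ∀ I : Set ℝ, I.OrdConnected → Bornology.IsBounded I → 0 < volume.real I →
    μ (carlesonSquare I) ≤ ENNReal.ofReal (C / Φ (1 / volume.real I ^ s))

/-- An `(α, Φ)`-Carleson measure is a `(2 + α, Φ)`-Carleson measure in the sense above. -/
def IsCarleson (α : ℝ) (Φ : ℝ → ℝ) (μ : Measure ℍ) : Prop := IsSCarleson (2 + α) Φ μ

/-- The measure `dV_α (x + i y) = y ^ α dx dy` on the upper half-plane. (Mathlib's `volume` on `ℍ`
is the hyperbolic measure, so Lebesgue measure is pulled back from `ℂ` here.) -/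
def V (α : ℝ) : Measure ℍ :=
  ((volume : Measure ℂ).comap UpperHalfPlane.coe).withDensity fun z => ENNReal.ofReal (z.im ^ α)

/-- The Luxemburg (quasi-)norm `inf {r > 0 : ∫ Φ (|F| / r) dV_α ≤ 1}`, with `inf ∅ = ∞`. -/
def luxNorm (α : ℝ) (Φ : ℝ → ℝ) (F : ℍ → ℂ) : ℝ≥0∞ :=
  ⨅ (r : ℝ) (_ : 0 < r ∧ ∫⁻ z, ENNReal.ofReal (Φ (‖F z‖ / r)) ∂(V α) ≤ 1), ENNReal.ofReal r

/-- The Bergman–Orlicz space `A_α^Φ(ℂ₊)`: holomorphic functions of finite Luxemburg norm. -/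
def bergmanOrlicz (α : ℝ) (Φ : ℝ → ℝ) : Set (ℍ → ℂ) :=
  {F | MDifferentiable 𝓘(ℂ) 𝓘(ℂ) F ∧ luxNorm α Φ F < ∞}

end BergmanOrlicz

end

/-! Only two consequences of membership in the two classes matter, and `Regular` records them: `Φ (s
t) ≤ t ^ a Φ s` for `t ≤ 1`, with `a` the lower index, and doubling. Neither convexity nor concavity
is used after `regular_of_class`.

Sufficiency of the Carleson condition rests on a local estimate: `y ^ (2 + α) Φ₁ |F(z)|` is at most
a constant times the integral of `Φ₁ |F|` over the Whitney disc of `z`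
(`Regular.exists_mul_rpow_le_setLIntegral`). For `F` with integral at most 1 it yields `|F(z)| ≤ T
:= Φ₁⁻¹(K / y ^ (2 + α))`. As `Φ₂ / Φ₁` is nondecreasing, `Φ₂ |F(z)| ≤ (Φ₂ T / Φ₁ T) Φ₁ |F(z)|`.
Apply the local estimate again to the last factor, integrate against `μ` and exchange the integrals:
the points `z` whose Whitney disc contains `w` lie in a Carleson square of side `2 Im w`, whose mass
cancels the weight `Φ₂ T` up to a constant (`IsCarleson.exists_lintegral_le`).

Necessity uses powers of the kernel `y / |w - z̄|`, normalised to have bounded norm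
(`Regular.exists_test_function`). The kernel is bounded below on the Carleson square below `z`, so
either the strong or the weak type bound on these functions controls the mass of the square.
Chebyshev's inequality passes from strong to weak type. -/

namespace BergmanOrlicz

/-! ### Growth functions: positivity, doubling and the lower index. -/

/-- A positive growth function that decays under contraction at the rate `t ^ a` and grows under
dilation by at most a constant factor. -/
structure Regular (Φ : ℝ → ℝ) (a : ℝ) : Prop where
  index_pos : 0 < a
  growth : IsGrowth Φ
  pos : ∀ t, 0 < t → 0 < Φ t
  scale : ∀ t, 0 < t → t ≤ 1 → ∀ s, 0 ≤ s → Φ (s * t) ≤ t ^ a * Φ s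
  doubling : ∀ K, 0 < K → ∃ C, 0 < C ∧ ∀ s, 0 ≤ s → Φ (K * s) ≤ C * Φ s

namespace IsGrowth

variable {Φ : ℝ → ℝ}

lemma nonneg (h : IsGrowth Φ) {t : ℝ} (ht : 0 ≤ t) : 0 ≤ Φ t := by
  have : Φ t ∈ Φ '' Ici 0 := ⟨t, ht, rfl⟩
  rwa [h.image_eq] at this

lemma map_zero (h : IsGrowth Φ) : Φ 0 = 0 := by
  obtain ⟨x, hx, hx0⟩ : (0 : ℝ) ∈ Φ '' Ici 0 := by rw [h.image_eq]; exact self_mem_Ici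
  exact le_antisymm (hx0 ▸ h.monotoneOn self_mem_Ici hx hx) (h.nonneg le_rfl)

/-- A growth function takes the value 1 somewhere. A zero at `t > 0` excludes this to the left of
`t` by monotonicity and to the right by `h0`. -/
lemma pos_of_forall_le (h : IsGrowth Φ)
    (h0 : ∀ s, 0 < s → Φ s = 0 → ∀ t, s ≤ t → Φ t ≤ 0) (t : ℝ) (ht : 0 < t) : 0 < Φ t := by
  rcases (h.nonneg ht.le).eq_or_lt with h1 | h1
  · obtain ⟨x, hx, hx1⟩ : (1 : ℝ) ∈ Φ '' Ici 0 := by rw [h.image_eq]; exact mem_Ici.2 zero_le_one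
    rcases le_total x t with hxt | hxt
    · have := h.monotoneOn hx ht.le hxt
      linarith
    · have := h0 t ht h1.symm x hxt
      linarith
  · exact h1

end IsGrowth

variable {Φ : ℝ → ℝ} {a : ℝ}

lemma ClassU.pos (h : ClassU Φ) (t : ℝ) (ht : 0 < t) : 0 < Φ t := by
  refine h.growth.pos_of_forall_le (fun s hs hs0 t hst => ?_) t ht
  obtain ⟨q, -, C, -, hC⟩ := h.upperType
  have := hC (t / s) ((one_le_div hs).2 hst) s hs
  rwa [mul_div_cancel₀ _ hs.ne', hs0, mul_zero] at this

lemma ClassL.pos (h : ClassL Φ) (t : ℝ) (ht : 0 < t) : 0 < Φ t := by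
  refine h.growth.pos_of_forall_le (fun s hs hs0 t hst => ?_) t ht
  have := h.antitoneOn_div hs (hs.trans_le hst : (0 : ℝ) < t) hst
  simp only [hs0, zero_div] at this
  by_contra! hc
  have := div_pos hc (hs.trans_le hst)
  linarith

lemma ClassU.doubling (h : ClassU Φ) (K : ℝ) (hK : 0 < K) :
    ∃ C, 0 < C ∧ ∀ s, 0 ≤ s → Φ (K * s) ≤ C * Φ s := by
  obtain ⟨q, -, C, hC0, hC⟩ := h.upperType
  have hM : (0 : ℝ) < max K 1 := lt_max_of_lt_right one_pos
  refine ⟨C * max K 1 ^ q, by positivity, fun s hs => ?_⟩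
  rcases hs.eq_or_lt with rfl | hs
  · simp [h.growth.map_zero]
  · refine le_trans (h.growth.monotoneOn (mul_pos hK hs).le (mul_pos hs hM).le ?_)
      (hC _ (le_max_right _ _) s hs)
    rw [mul_comm]
    gcongr
    exact le_max_left _ _

lemma ClassL.doubling (h : ClassL Φ) (K : ℝ) (hK : 0 < K) :
    ∃ C, 0 < C ∧ ∀ s, 0 ≤ s → Φ (K * s) ≤ C * Φ s := by
  have hM : (0 : ℝ) < max K 1 := lt_max_of_lt_right one_pos
  refine ⟨max K 1, hM, fun s hs => ?_⟩
  rcases hs.eq_or_lt with rfl | hs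
  · simp [h.growth.map_zero]
  · have h1 : Φ (K * s) ≤ Φ (max K 1 * s) :=
      h.growth.monotoneOn (mul_pos hK hs).le (mul_pos hM hs).le (by gcongr; exact le_max_left _ _)
    have h2 := h.antitoneOn_div hs (mul_pos hM hs : (0 : ℝ) < max K 1 * s)
      (le_mul_of_one_le_left hs.le (le_max_right _ _))
    simp only at h2
    rw [div_le_div_iff₀ (mul_pos hM hs) hs] at h2
    refine h1.trans (le_of_mul_le_mul_right (h2.trans_eq ?_) hs)
    ring

lemma ClassU.deriv_bound (h : ClassU Φ) : ∃ c, 0 < c ∧ ∀ t, 0 < t → c * Φ t ≤ t * deriv Φ t := by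
  refine ⟨1, one_pos, fun t ht => ?_⟩
  have hd : DifferentiableAt ℝ Φ t :=
    (h.contDiffOn.differentiableOn one_ne_zero).differentiableAt (Ioi_mem_nhds ht)
  have := h.convexOn.slope_le_deriv self_mem_Ici ht.le ht hd
  rw [slope_def_field, h.growth.map_zero, sub_zero, sub_zero, div_le_iff₀ ht] at this
  linarith

lemma ClassL.deriv_bound (h : ClassL Φ) : ∃ c, 0 < c ∧ ∀ t, 0 < t → c * Φ t ≤ t * deriv Φ t := by
  obtain ⟨p, hp, -, C, hC0, hC⟩ := h.lowerType
  -- With this `M` the lower type gives `Φ (M t) ≥ 2 Φ t`. By concavity the slope over `[t, M t]`,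
  -- at least `Φ t / ((M - 1) t)`, is at most `Φ' t`.
  obtain ⟨M, hM1, hM⟩ : ∃ M : ℝ, 1 < M ∧ 2 * C ≤ M ^ p :=
    ((Filter.eventually_gt_atTop 1).and
      ((tendsto_rpow_atTop hp).eventually_ge_atTop (2 * C))).exists
  have hM0 : 0 < M := by linarith
  refine ⟨1 / (M - 1), by simpa using hM1, fun t ht => ?_⟩
  have hd : DifferentiableAt ℝ Φ t :=
    (h.contDiffOn.differentiableOn one_ne_zero).differentiableAt (Ioi_mem_nhds ht)
  have hMt : t < M * t := by nlinarith
  have h1 := h.concaveOn.slope_le_deriv (mem_Ici.2 ht.le)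
    (mem_Ici.2 (mul_pos hM0 ht).le) hMt hd
  rw [slope_def_field, show M * t - t = (M - 1) * t by ring,
    div_le_iff₀ (mul_pos (by linarith) ht)] at h1
  have h2 := hC M⁻¹ (by positivity) (inv_le_one_of_one_le₀ hM1.le) (M * t) (by positivity)
  rw [mul_assoc, mul_comm t, mul_inv_cancel_left₀ hM0.ne' t,
    Real.inv_rpow hM0.le, ← div_eq_mul_inv, div_mul_eq_mul_div, le_div_iff₀ (by positivity)] at h2
  have h3 := h.pos t ht
  have h4 : 2 * Φ t ≤ Φ (M * t) := by
    have : Φ t * (2 * C) ≤ Φ t * M ^ p := by gcongr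
    have : C * (2 * Φ t) ≤ C * Φ (M * t) := by linarith
    exact le_of_mul_le_mul_left this hC0
  rw [one_div_mul_eq_div, div_le_iff₀ (by linarith)]
  linarith

lemma lowerIndex_mul_le (hpos : ∀ t, 0 < t → 0 < Φ t)
    (hd : ∃ c, 0 < c ∧ ∀ t, 0 < t → c * Φ t ≤ t * deriv Φ t) :
    0 < lowerIndex Φ ∧ ∀ t, 0 < t → lowerIndex Φ * Φ t ≤ t * deriv Φ t := by
  obtain ⟨c, hc, hb⟩ := hd
  have hb' : ∀ t : Ioi (0 : ℝ), c ≤ (t : ℝ) * deriv Φ t / Φ t := fun t =>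
    (le_div_iff₀ (hpos _ t.2)).2 (hb _ t.2)
  have : Nonempty (Ioi (0 : ℝ)) := ⟨⟨1, mem_Ioi.2 one_pos⟩⟩
  refine ⟨hc.trans_le (le_ciInf hb'), fun t ht => ?_⟩
  rw [← le_div_iff₀ (hpos t ht)]
  exact ciInf_le ⟨c, by rintro _ ⟨t, rfl⟩; exact hb' t⟩ (⟨t, ht⟩ : Ioi (0 : ℝ))

/-- The inequality `a Φ ≤ t Φ'` says exactly that `t ↦ Φ t * t ^ (-a)` has nonnegative derivative;
compare its values at `s t` and `s`. -/
lemma map_mul_le_rpow_mul (hg : IsGrowth Φ)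
    (hdiff : DifferentiableOn ℝ Φ (Ioi 0)) (hd : ∀ t, 0 < t → a * Φ t ≤ t * deriv Φ t)
    (t : ℝ) (ht : 0 < t) (ht1 : t ≤ 1) (s : ℝ) (hs : 0 ≤ s) : Φ (s * t) ≤ t ^ a * Φ s := by
  rcases hs.eq_or_lt with rfl | hs
  · simp [hg.map_zero]
  have hder : ∀ x : ℝ, 0 < x → HasDerivAt (fun t => Φ t * t ^ (-a))
      (deriv Φ x * x ^ (-a) + Φ x * (-a * x ^ (-a - 1))) x := fun x hx =>
    (hdiff.differentiableAt (Ioi_mem_nhds hx)).hasDerivAt.mul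
      (Real.hasDerivAt_rpow_const (Or.inl hx.ne'))
  have hmono : MonotoneOn (fun t => Φ t * t ^ (-a)) (Ioi 0) := by
    refine monotoneOn_of_deriv_nonneg (convex_Ioi 0)
      (fun x hx => (hder x hx).continuousAt.continuousWithinAt) ?_ ?_
    · rw [interior_Ioi]
      exact fun x hx => (hder x hx).differentiableAt.differentiableWithinAt
    · rw [interior_Ioi]
      intro x hx
      have hx0 : 0 < x := hx
      rw [(hder x hx).deriv, Real.rpow_sub_one hx0.ne']
      have h1 : 0 ≤ x ^ (-a) / x := by positivity
      have h2 := mul_nonneg h1 (sub_nonneg.2 (hd x hx))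
      refine h2.trans_eq ?_
      field_simp
      ring
  have hst : 0 < s * t := mul_pos hs ht
  have := hmono hst hs (mul_le_of_le_one_right hs.le ht1)
  simp only [Real.mul_rpow hs.le ht.le] at this
  rw [mul_comm (s ^ (-a)), ← mul_assoc] at this
  have := le_of_mul_le_mul_right this (by positivity)
  rwa [Real.rpow_neg ht.le, ← div_eq_mul_inv, div_le_iff₀ (by positivity), mul_comm (Φ s)] at this

theorem regular_of_class (h : ClassL Φ ∨ ClassU Φ) : Regular Φ (lowerIndex Φ) := by
  rcases h with h | h
  · obtain ⟨h1, h2⟩ := lowerIndex_mul_le h.pos h.deriv_bound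
    exact ⟨h1, h.growth, h.pos, map_mul_le_rpow_mul h.growth
      (h.contDiffOn.differentiableOn one_ne_zero) h2, h.doubling⟩
  · obtain ⟨h1, h2⟩ := lowerIndex_mul_le h.pos h.deriv_bound
    exact ⟨h1, h.growth, h.pos, map_mul_le_rpow_mul h.growth
      (h.contDiffOn.differentiableOn one_ne_zero) h2, h.doubling⟩

namespace Regular

lemma nonneg (h : Regular Φ a) {t : ℝ} (ht : 0 ≤ t) : 0 ≤ Φ t := h.growth.nonneg ht

lemma mono (h : Regular Φ a) {s t : ℝ} (hs : 0 ≤ s) (hst : s ≤ t) : Φ s ≤ Φ t :=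
  h.growth.monotoneOn hs (hs.trans hst) hst

/-- Dividing the argument by `K ≥ 1` divides the value by at least `K ^ a`. -/
lemma rpow_mul_le (h : Regular Φ a) {K : ℝ} (hK : 1 ≤ K) {s : ℝ} (hs : 0 ≤ s) :
    K ^ a * Φ s ≤ Φ (K * s) := by
  have hK0 : 0 < K := by linarith
  have := h.scale K⁻¹ (by positivity) (inv_le_one_of_one_le₀ hK) (K * s) (by positivity)
  rwa [mul_comm K s, mul_inv_cancel_right₀ hK0.ne', Real.inv_rpow hK0.le, inv_mul_eq_div,
    le_div_iff₀ (by positivity), mul_comm, mul_comm s] at this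

lemma strictMonoOn (h : Regular Φ a) : StrictMonoOn Φ (Ici 0) := by
  intro s hs t ht hst
  have ht0 : 0 < t := lt_of_le_of_lt hs hst
  rcases (mem_Ici.1 hs).eq_or_lt with rfl | hs0
  · rw [h.growth.map_zero]; exact h.pos t ht0
  · have h1 := h.rpow_mul_le ((one_le_div hs0).2 hst.le) hs0.le
    rw [div_mul_cancel₀ _ hs0.ne'] at h1
    refine lt_of_lt_of_le ?_ h1
    exact lt_mul_of_one_lt_left (h.pos s hs0)
      (Real.one_lt_rpow ((one_lt_div hs0).2 hst) h.index_pos)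

lemma le_iff_le (h : Regular Φ a) {s t : ℝ} (hs : 0 ≤ s) (ht : 0 ≤ t) : Φ s ≤ Φ t ↔ s ≤ t :=
  h.strictMonoOn.le_iff_le hs ht

lemma inv_nonneg (h : Regular Φ a) {u : ℝ} (hu : 0 ≤ u) : 0 ≤ inv Φ u := by
  have : u ∈ Φ '' Ici 0 := by rw [h.growth.image_eq]; exact hu
  exact Function.invFunOn_mem this

lemma map_inv (h : Regular Φ a) {u : ℝ} (hu : 0 ≤ u) : Φ (inv Φ u) = u := by
  have : u ∈ Φ '' Ici 0 := by rw [h.growth.image_eq]; exact hu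
  exact Function.invFunOn_eq this

lemma inv_pos (h : Regular Φ a) {u : ℝ} (hu : 0 < u) : 0 < inv Φ u := by
  refine (h.inv_nonneg hu.le).lt_of_ne' fun h0 => ?_
  have := h.map_inv hu.le
  rw [h0, h.growth.map_zero] at this
  exact hu.ne this

lemma le_inv_iff (h : Regular Φ a) {s u : ℝ} (hs : 0 ≤ s) (hu : 0 ≤ u) :
    s ≤ inv Φ u ↔ Φ s ≤ u := by
  rw [← h.le_iff_le hs (h.inv_nonneg hu), h.map_inv hu]

/-- A bound on the ratio of values yields a bound on the ratio of arguments. -/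
lemma le_mul_of_map_le (h : Regular Φ a) {K : ℝ} (hK : 1 ≤ K) {s t : ℝ} (hs : 0 ≤ s) (ht : 0 ≤ t)
    (hst : Φ s ≤ K * Φ t) : s ≤ K ^ (1 / a) * t := by
  have hK0 : 0 < K := by linarith
  have h1 := h.rpow_mul_le (Real.one_le_rpow hK (one_div_pos.2 h.index_pos).le) ht
  rw [← Real.rpow_mul hK0.le, one_div_mul_cancel h.index_pos.ne', Real.rpow_one] at h1
  exact (h.le_iff_le hs (by positivity)).1 (hst.trans h1)

/-- The inverse is doubling. -/
lemma inv_mul_le (h : Regular Φ a) {K : ℝ} (hK : 1 ≤ K) {u : ℝ} (hu : 0 ≤ u) :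
    inv Φ (K * u) ≤ K ^ (1 / a) * inv Φ u := by
  have hK0 : 0 ≤ K := by linarith
  apply h.le_mul_of_map_le hK (h.inv_nonneg (by positivity)) (h.inv_nonneg hu)
  rw [h.map_inv (by positivity), h.map_inv hu]

lemma inv_mono (h : Regular Φ a) {u v : ℝ} (hu : 0 ≤ u) (huv : u ≤ v) : inv Φ u ≤ inv Φ v := by
  rw [h.le_inv_iff (h.inv_nonneg hu) (hu.trans huv), h.map_inv hu]
  exact huv

lemma measurable_comp (h : Regular Φ a) {X : Type*} [MeasurableSpace X] {f : X → ℝ}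
    (hf : Measurable f) (hf0 : ∀ x, 0 ≤ f x) : Measurable fun x => Φ (f x) := by
  -- `Φ` is controlled only on `[0, ∞)`, so it is replaced by a continuous extension that agrees
  -- with it there.
  have hc : Continuous fun t => Φ (max t 0) :=
    h.growth.continuousOn.comp_continuous (by fun_prop) fun t => mem_Ici.2 (le_max_right _ _)
  convert hc.measurable.comp hf using 2 with x
  simp [hf0]

end Regular

/-! ### Sub-mean value estimates on Euclidean and Whitney discs. -/

lemma two_pi_mul_enorm_le_lintegral_circle {f : ℂ → ℂ} {c : ℂ} {r : ℝ} (hr : 0 ≤ r)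
    (hf : DiffContOnCl ℂ f (Metric.ball c r)) :
    ENNReal.ofReal (2 * Real.pi) * ‖f c‖ₑ
      ≤ ∫⁻ θ in Ioo (-Real.pi) Real.pi, ‖f (circleMap c r θ)‖ₑ := by
  have h1 : Real.circleAverage f c r = f c :=
    DiffContOnCl.circleAverage (by rwa [abs_of_nonneg hr])
  rw [Real.circleAverage_eq_integral_add (-Real.pi),
    intervalIntegral.integral_comp_add_right (fun θ => f (circleMap c r θ))] at h1
  have h2 : ∫ θ in Ioo (-Real.pi) Real.pi, f (circleMap c r θ) = (2 * Real.pi) • f c := by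
    rw [← h1, smul_smul, mul_inv_cancel₀ (by positivity), one_smul,
      show (0 : ℝ) + -Real.pi = -Real.pi by ring, show 2 * Real.pi + -Real.pi = Real.pi by ring,
      intervalIntegral.integral_of_le (by linarith [Real.pi_pos]), integral_Ioc_eq_integral_Ioo]
  calc ENNReal.ofReal (2 * Real.pi) * ‖f c‖ₑ = ‖(2 * Real.pi) • f c‖ₑ := by
        rw [enorm_smul, Real.enorm_of_nonneg (by positivity)]
    _ ≤ _ := by rw [← h2]; exact enorm_integral_le_lintegral_enorm _

lemma lintegral_ofReal_Ioo {R : ℝ} (hR : 0 ≤ R) :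
    ∫⁻ r in Ioo 0 R, ENNReal.ofReal r = ENNReal.ofReal (R ^ 2 / 2) := by
  rw [← ofReal_integral_eq_lintegral_ofReal, ← integral_Ioc_eq_integral_Ioo,
    ← intervalIntegral.integral_of_le hR, integral_id]
  · simp
  · exact (continuous_id.integrableOn_Icc (a := 0) (b := R)).mono_set Ioo_subset_Icc_self
  · exact (ae_restrict_mem measurableSet_Ioo).mono fun r hr => hr.1.le

/-- The sub-mean value property of `|f|` over discs. -/
lemma area_mul_enorm_le_lintegral_ball {f : ℂ → ℂ} {c : ℂ} {R : ℝ} (hR : 0 ≤ R)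
    (hf : DiffContOnCl ℂ f (Metric.ball c R)) :
    ENNReal.ofReal (Real.pi * R ^ 2) * ‖f c‖ₑ ≤ ∫⁻ w in Metric.ball c R, ‖f w‖ₑ := by
  set g : ℂ → ℝ≥0∞ := (Metric.ball c R).indicator fun w => ‖f w‖ₑ with hg
  have hgm : Measurable g := by
    classical
    have : g = (Metric.ball c R).piecewise (fun w => ‖f w‖ₑ) 0 := by
      rw [hg, piecewise_eq_indicator]
    rw [this]
    exact (hf.1.continuousOn.enorm).measurable_piecewise continuousOn_const measurableSet_ball
  have hgc : Measurable fun p : ℝ × ℝ =>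
      ENNReal.ofReal p.1 • g (c + Complex.polarCoord.symm p) := by
    simp only [Complex.polarCoord_symm_apply, smul_eq_mul]
    refine Measurable.mul (by fun_prop) (hgm.comp ?_)
    fun_prop
  rw [← lintegral_indicator measurableSet_ball, ← hg, ← lintegral_add_left_eq_self g c,
    ← Complex.lintegral_comp_polarCoord_symm, polarCoord_target, Measure.volume_eq_prod,
    ← Measure.prod_restrict, lintegral_prod _ hgc.aemeasurable]
  -- In polar coordinates about `c`, the circle estimate holds at each radius; integrating the
  -- weight `r` then gives `R ^ 2 / 2`.
  have key : ∀ r ∈ Ioo 0 R, ENNReal.ofReal r * (ENNReal.ofReal (2 * Real.pi) * ‖f c‖ₑ) ≤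
      ∫⁻ θ in Ioo (-Real.pi) Real.pi,
        ENNReal.ofReal r • g (c + Complex.polarCoord.symm (r, θ)) := by
    intro r hr
    simp only [smul_eq_mul]
    rw [lintegral_const_mul']
    · gcongr
      refine (two_pi_mul_enorm_le_lintegral_circle hr.1.le
        (hf.mono (Metric.ball_subset_ball hr.2.le))).trans_eq ?_
      refine lintegral_congr fun θ => ?_
      have h1 : c + Complex.polarCoord.symm (r, θ) = circleMap c r θ := by
        rw [Complex.polarCoord_symm_apply, circleMap, Complex.exp_mul_I]
        push_cast
        ring
      rw [h1, hg, indicator_of_mem]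
      rw [Metric.mem_ball, dist_eq_norm, circleMap_sub_center, norm_circleMap_zero,
        abs_of_pos hr.1]
      exact hr.2
    · exact ENNReal.ofReal_ne_top
  calc ENNReal.ofReal (Real.pi * R ^ 2) * ‖f c‖ₑ
      = ∫⁻ r in Ioo 0 R, ENNReal.ofReal r * (ENNReal.ofReal (2 * Real.pi) * ‖f c‖ₑ) := by
        rw [lintegral_mul_const _ (by fun_prop), lintegral_ofReal_Ioo hR, ← mul_assoc,
          ← ENNReal.ofReal_mul (by positivity)]
        congr 2
        ring
    _ ≤ ∫⁻ r in Ioo 0 R, ∫⁻ θ in Ioo (-Real.pi) Real.pi,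
        ENNReal.ofReal r • g (c + Complex.polarCoord.symm (r, θ)) :=
        setLIntegral_mono' measurableSet_Ioo key
    _ ≤ _ := lintegral_mono_set Ioo_subset_Ioi_self

/-- Hardy–Littlewood type sub-mean value property: no convexity of `Φ` is needed, at the cost of a
constant. -/
theorem Regular.exists_sq_mul_le_lintegral_ball {Φ : ℝ → ℝ} {a : ℝ} (h : Regular Φ a) :
    ∃ C : ℝ, 0 < C ∧ ∀ (f : ℂ → ℂ) (c : ℂ) (R : ℝ), 0 < R → DiffContOnCl ℂ f (Metric.ball c R) →
      ENNReal.ofReal (R ^ 2 * Φ ‖f c‖)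
        ≤ ENNReal.ofReal C * ∫⁻ w in Metric.ball c R, ENNReal.ofReal (Φ ‖f w‖) := by
  obtain ⟨D, hD0, hD⟩ := h.doubling 2 two_pos
  set K : ℝ := 4 ^ (1 / a) with hK
  have hK0 : 0 < K := by positivity
  have hpi := Real.pi_pos
  refine ⟨8 * K * D / Real.pi, by positivity, fun f c R hR hf => ?_⟩
  have hcb : closure (Metric.ball c R) = Metric.closedBall c R := closure_ball c hR.ne'
  have hfc : ContinuousOn f (Metric.closedBall c R) := hcb ▸ hf.2
  -- The weight vanishes on the boundary circle, so a maximum point of positive value has a disc of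
  -- radius `d / 2` around it inside the ball. There the weight is at least `d ^ 2 / 4`, so `Φ |f| ≤
  -- 4 Φ m`, whence `|f| ≤ K m` with `K = 4 ^ (1 / a)`.
  obtain ⟨w, hw, hmax⟩ := (isCompact_closedBall c R).exists_isMaxOn
    ⟨c, Metric.mem_closedBall_self hR.le⟩
    (f := fun w => (R - dist w c) ^ 2 * Φ ‖f w‖)
    (ContinuousOn.mul (by fun_prop)
      (h.growth.continuousOn.comp hfc.norm fun x _ => norm_nonneg (f x)))
  set d := R - dist w c with hd
  set m := ‖f w‖ with hm
  have hd0 : 0 ≤ d := sub_nonneg.2 hw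
  have hcen : R ^ 2 * Φ ‖f c‖ ≤ d ^ 2 * Φ m := by
    have := hmax (Metric.mem_closedBall_self hR.le)
    simpa using this
  rcases (mul_nonneg (sq_nonneg d) (h.nonneg (norm_nonneg _ : 0 ≤ m))).eq_or_lt with h0 | h0
  · rw [ENNReal.ofReal_of_nonpos (hcen.trans_eq h0.symm)]
    exact zero_le
  have hdpos : 0 < d := hd0.lt_of_ne' fun h' => by simp [h'] at h0
  have hmpos : 0 < m := (norm_nonneg _).lt_of_ne' fun h' => by
    simp [h', h.growth.map_zero] at h0
  have hsub : Metric.ball w (d / 2) ⊆ Metric.ball c R := by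
    intro u hu
    have := dist_triangle u w c
    rw [Metric.mem_ball] at hu ⊢
    linarith
  have hPhi : 0 < Φ (m / 2) := h.pos _ (by positivity)
  -- Either `|f u| ≤ m / 2`, or `Φ |f u| ≥ Φ (m / 2)` and the bound `|f u| ≤ K m` can be multiplied
  -- by a ratio at least 1.
  have hpt : ∀ u ∈ Metric.ball w (d / 2),
      ‖f u‖ₑ ≤ ENNReal.ofReal (m / 2) + ENNReal.ofReal (K * m / Φ (m / 2)) *
        ENNReal.ofReal (Φ ‖f u‖) := by
    intro u hu
    rw [← ENNReal.ofReal_mul (by positivity), ← ENNReal.ofReal_add (by positivity)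
      (mul_nonneg (by positivity) (h.nonneg (norm_nonneg _))), ← ofReal_norm]
    apply ENNReal.ofReal_le_ofReal
    rcases le_total ‖f u‖ (m / 2) with h1 | h1
    · have : 0 ≤ K * m / Φ (m / 2) * Φ ‖f u‖ :=
        mul_nonneg (by positivity) (h.nonneg (norm_nonneg _))
      linarith
    · have h2 : ‖f u‖ ≤ K * m := by
        refine h.le_mul_of_map_le (by norm_num) (norm_nonneg _) hmpos.le ?_
        have h3 := hmax (Metric.ball_subset_closedBall (hsub hu))
        simp only at h3
        have h4 : d / 2 ≤ R - dist u c := by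
          have := dist_triangle u w c
          rw [Metric.mem_ball] at hu
          linarith
        have h5 : (d / 2) ^ 2 * Φ ‖f u‖ ≤ (R - dist u c) ^ 2 * Φ ‖f u‖ := by
          have := h.nonneg (norm_nonneg (f u))
          gcongr
        have h6 : d ^ 2 * Φ ‖f u‖ ≤ d ^ 2 * (4 * Φ m) := by
          have := h5.trans h3
          change _ ≤ d ^ 2 * Φ m at this
          linarith
        exact le_of_mul_le_mul_left h6 (by positivity)
      have h3 : Φ (m / 2) ≤ Φ ‖f u‖ := h.mono (by positivity) h1
      have h4 : K * m ≤ K * m / Φ (m / 2) * Φ ‖f u‖ := by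
        rw [div_mul_eq_mul_div, le_div_iff₀ hPhi]
        gcongr
      linarith
  set I := ∫⁻ u in Metric.ball c R, ENNReal.ofReal (Φ ‖f u‖) with hI
  have hvol : (volume : Measure ℂ) (Metric.ball w (d / 2)) =
      ENNReal.ofReal (Real.pi * (d / 2) ^ 2) := by
    rw [Complex.volume_ball, ENNReal.ofReal_mul hpi.le, ENNReal.ofReal_pow (by positivity),
      mul_comm]
    congr 1
    rw [← NNReal.coe_real_pi, ENNReal.ofReal_coe_nnreal]
  have hmain : ENNReal.ofReal (Real.pi * (d / 2) ^ 2) * ENNReal.ofReal m ≤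
      ENNReal.ofReal (m / 2) * ENNReal.ofReal (Real.pi * (d / 2) ^ 2) +
        ENNReal.ofReal (K * m / Φ (m / 2)) * I := by
    calc ENNReal.ofReal (Real.pi * (d / 2) ^ 2) * ENNReal.ofReal m
        ≤ ∫⁻ u in Metric.ball w (d / 2), ‖f u‖ₑ := by
          rw [hm, ofReal_norm]
          exact area_mul_enorm_le_lintegral_ball (by positivity) (hf.mono hsub)
      _ ≤ ∫⁻ u in Metric.ball w (d / 2), (ENNReal.ofReal (m / 2) +
          ENNReal.ofReal (K * m / Φ (m / 2)) * ENNReal.ofReal (Φ ‖f u‖)) :=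
          setLIntegral_mono' measurableSet_ball hpt
      _ ≤ _ := by
          rw [lintegral_add_left measurable_const, setLIntegral_const, hvol,
            lintegral_const_mul' _ _ ENNReal.ofReal_ne_top]
          gcongr
          exact lintegral_mono_set hsub
  rcases eq_or_ne I ∞ with hItop | hItop
  · rw [hItop, ENNReal.mul_top (by simpa using by positivity)]
    exact le_top
  rw [← ENNReal.ofReal_toReal hItop, ← ENNReal.ofReal_mul (by positivity),
    ← ENNReal.ofReal_mul (by positivity), ← ENNReal.ofReal_mul (by positivity),
    ← ENNReal.ofReal_add (by positivity) (by positivity),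
    ENNReal.ofReal_le_ofReal_iff (by positivity)] at hmain
  rw [← ENNReal.ofReal_toReal hItop, ← ENNReal.ofReal_mul (by positivity)]
  apply ENNReal.ofReal_le_ofReal
  refine hcen.trans ?_
  set i := I.toReal
  have h1 : Φ m ≤ D * Φ (m / 2) := by
    have := hD (m / 2) (by positivity)
    rwa [mul_div_cancel₀ _ two_ne_zero] at this
  -- The term with `m / 2` is absorbed into the left side of `hmain`, and the common factor `m`
  -- cancels.
  have h2 : Real.pi * d ^ 2 * Φ (m / 2) ≤ 8 * K * i := by
    have h3 : Real.pi * (d / 2) ^ 2 * m - m / 2 * (Real.pi * (d / 2) ^ 2) ≤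
        K * m / Φ (m / 2) * i := by linarith
    have h4 : m * (Real.pi * d ^ 2 / 8) ≤ m * (K * i / Φ (m / 2)) := by
      convert h3 using 1 <;> ring
    have h5 := le_of_mul_le_mul_left h4 hmpos
    rw [div_le_div_iff₀ (by norm_num) hPhi] at h5
    linarith
  calc d ^ 2 * Φ m ≤ d ^ 2 * (D * Φ (m / 2)) := by gcongr
    _ = D / Real.pi * (Real.pi * d ^ 2 * Φ (m / 2)) := by field_simp
    _ ≤ D / Real.pi * (8 * K * i) := by gcongr
    _ = _ := by ring

lemma rpow_le_two_rpow_abs_mul {x y : ℝ} (hx : 0 < x) (hy : 0 < y) (h1 : x ≤ 2 * y)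
    (h2 : y ≤ 2 * x) (β : ℝ) : y ^ β ≤ 2 ^ |β| * x ^ β := by
  rcases le_total 0 β with hβ | hβ
  · rw [abs_of_nonneg hβ, ← Real.mul_rpow two_pos.le hx.le]
    exact Real.rpow_le_rpow hy.le h2 hβ
  · rw [abs_of_nonpos hβ, Real.rpow_neg two_pos.le, ← Real.inv_rpow two_pos.le,
      ← Real.mul_rpow (by positivity) hx.le]
    exact Real.rpow_le_rpow_of_nonpos (by positivity) (by linarith) hβ

lemma setLIntegral_comap_coe {S : Set ℂ} (hS : MeasurableSet S) (hS' : S ⊆ {w : ℂ | 0 < w.im})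
    (g : ℂ → ℝ≥0∞) :
    ∫⁻ w in UpperHalfPlane.coe ⁻¹' S, g w ∂((volume : Measure ℂ).comap UpperHalfPlane.coe)
      = ∫⁻ w in S, g w := by
  have he := UpperHalfPlane.measurableEmbedding_coe
  rw [← he.lintegral_map, ← he.restrict_map, he.map_comap, Measure.restrict_restrict hS,
    inter_eq_left.2 (hS'.trans_eq UpperHalfPlane.range_coe.symm)]

lemma setLIntegral_V (α : ℝ) {S : Set ℍ} (hS : MeasurableSet S) (g : ℍ → ℝ≥0∞) (hg : Measurable g) :
    ∫⁻ w in S, g w ∂(V α) = ∫⁻ w in S, ENNReal.ofReal (w.im ^ α) * g w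
      ∂((volume : Measure ℂ).comap UpperHalfPlane.coe) := by
  have hm : Measurable fun w : ℍ => ENNReal.ofReal (w.im ^ α) := by
    have : Measurable UpperHalfPlane.im := UpperHalfPlane.continuous_im.measurable
    fun_prop
  rw [V, setLIntegral_withDensity_eq_setLIntegral_mul _ hm hg hS]
  rfl

/-- The Whitney disc of centre `z` and radius `z.im / 2`. -/
def whitneyDisc (z : ℍ) : Set ℍ := {w | dist (w : ℂ) z < z.im / 2}

lemma im_bounds_of_mem_whitneyDisc {z w : ℍ} (h : w ∈ whitneyDisc z) :
    z.im / 2 < w.im ∧ w.im < 3 / 2 * z.im ∧ |z.re - w.re| < z.im / 2 := by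
  have h0 : ‖(w : ℂ) - z‖ < z.im / 2 := by rw [← dist_eq_norm]; exact h
  have h1 := (Complex.abs_im_le_norm _).trans_lt h0
  have h2 := (Complex.abs_re_le_norm _).trans_lt h0
  simp only [Complex.sub_im, Complex.sub_re, UpperHalfPlane.coe_im, UpperHalfPlane.coe_re] at h1 h2
  rw [abs_lt] at h1
  rw [abs_sub_comm] at h2
  exact ⟨by linarith, by linarith, h2⟩

lemma measurable_of_mdifferentiable {F : ℍ → ℂ} (hF : MDifferentiable 𝓘(ℂ) 𝓘(ℂ) F) :
    Measurable F := hF.continuous.measurable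

theorem Regular.exists_mul_rpow_le_setLIntegral {Φ : ℝ → ℝ} {a : ℝ} (h : Regular Φ a) (α : ℝ) :
    ∃ C : ℝ, 0 < C ∧ ∀ F : ℍ → ℂ, MDifferentiable 𝓘(ℂ) 𝓘(ℂ) F → ∀ z : ℍ,
      ENNReal.ofReal (z.im ^ (2 + α) * Φ ‖F z‖)
        ≤ ENNReal.ofReal C * ∫⁻ w in whitneyDisc z, ENNReal.ofReal (Φ ‖F w‖) ∂(V α) := by
  obtain ⟨C, hC0, hC⟩ := h.exists_sq_mul_le_lintegral_ball
  refine ⟨4 * C * 2 ^ |α|, by positivity, fun F hF z => ?_⟩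
  have hy : 0 < z.im := z.im_pos
  set f : ℂ → ℂ := F ∘ UpperHalfPlane.ofComplex with hf
  have hfd : DifferentiableOn ℂ f {w | 0 < w.im} := UpperHalfPlane.mdifferentiable_iff.1 hF
  have hfF : ∀ w : ℍ, f w = F w := fun w => by simp [hf]
  have him : ∀ w ∈ Metric.closedBall (z : ℂ) (z.im / 2), 0 < w.im := by
    intro w hw
    have h1 : |(w - z).im| ≤ z.im / 2 :=
      (Complex.abs_im_le_norm _).trans (by rw [← dist_eq_norm]; exact hw)
    rw [Complex.sub_im, UpperHalfPlane.coe_im, abs_le] at h1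
    linarith
  have hdc : DiffContOnCl ℂ f (Metric.ball (z : ℂ) (z.im / 2)) := by
    refine DifferentiableOn.diffContOnCl ?_
    rw [closure_ball _ (by positivity)]
    exact hfd.mono him
  have key := hC f z (z.im / 2) (by positivity) hdc
  rw [hfF, ← setLIntegral_comap_coe measurableSet_ball
    (fun w hw => him w (Metric.ball_subset_closedBall hw))] at key
  simp only [hfF] at key
  have hWD : UpperHalfPlane.coe ⁻¹' Metric.ball (z : ℂ) (z.im / 2) = whitneyDisc z := rfl
  rw [hWD] at key
  have hWm : MeasurableSet (whitneyDisc z) :=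
    UpperHalfPlane.measurable_coe measurableSet_ball
  have hm : Measurable fun w => ENNReal.ofReal (Φ ‖F w‖) :=
    (h.measurable_comp (measurable_of_mdifferentiable hF).norm
      fun _ => norm_nonneg _).ennreal_ofReal
  -- On the Whitney disc the heights are comparable within a factor 2, so `y ^ α` is comparable to
  -- the density of `V α`, whatever the sign of `α`.
  have hcmp : ENNReal.ofReal (z.im ^ α) * ∫⁻ w in whitneyDisc z, ENNReal.ofReal (Φ ‖F w‖)
        ∂((volume : Measure ℂ).comap UpperHalfPlane.coe)
      ≤ ENNReal.ofReal (2 ^ |α|) * ∫⁻ w in whitneyDisc z, ENNReal.ofReal (Φ ‖F w‖) ∂(V α) := by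
    rw [setLIntegral_V α hWm _ hm, ← lintegral_const_mul' _ _ ENNReal.ofReal_ne_top,
      ← lintegral_const_mul' _ _ ENNReal.ofReal_ne_top]
    refine setLIntegral_mono' hWm fun w hw => ?_
    rw [← mul_assoc, ← ENNReal.ofReal_mul (p := 2 ^ |α|) (by positivity)]
    gcongr
    obtain ⟨h1, h2, -⟩ := im_bounds_of_mem_whitneyDisc hw
    exact rpow_le_two_rpow_abs_mul w.im_pos hy (by linarith) (by linarith) α
  calc ENNReal.ofReal (z.im ^ (2 + α) * Φ ‖F z‖)
      = ENNReal.ofReal 4 * ENNReal.ofReal (z.im ^ α) *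
          ENNReal.ofReal ((z.im / 2) ^ 2 * Φ ‖F z‖) := by
        rw [← ENNReal.ofReal_mul (by norm_num), ← ENNReal.ofReal_mul (by positivity)]
        congr 1
        rw [Real.rpow_add hy, Real.rpow_two]
        ring
    _ ≤ ENNReal.ofReal 4 * ENNReal.ofReal (z.im ^ α) * (ENNReal.ofReal C *
          ∫⁻ w in whitneyDisc z, ENNReal.ofReal (Φ ‖F w‖)
            ∂((volume : Measure ℂ).comap UpperHalfPlane.coe)) := by gcongr
    _ = ENNReal.ofReal (4 * C) * (ENNReal.ofReal (z.im ^ α) *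
          ∫⁻ w in whitneyDisc z, ENNReal.ofReal (Φ ‖F w‖)
            ∂((volume : Measure ℂ).comap UpperHalfPlane.coe)) := by
        rw [ENNReal.ofReal_mul (by norm_num)]
        ring
    _ ≤ ENNReal.ofReal (4 * C) * (ENNReal.ofReal (2 ^ |α|) *
          ∫⁻ w in whitneyDisc z, ENNReal.ofReal (Φ ‖F w‖) ∂(V α)) := by gcongr
    _ = _ := by
        rw [← mul_assoc, ← ENNReal.ofReal_mul (by positivity)]

/-! ### The Luxemburg norm and pointwise growth. -/

section LuxNorm

variable {Φ : ℝ → ℝ} {a α : ℝ} {F : ℍ → ℂ}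

lemma exists_lintegral_le_one_of_luxNorm_lt {R : ℝ}
    (h : luxNorm α Φ F < ENNReal.ofReal R) :
    ∃ r, 0 < r ∧ r < R ∧ ∫⁻ z, ENNReal.ofReal (Φ (‖F z‖ / r)) ∂(V α) ≤ 1 := by
  simp only [luxNorm, iInf_lt_iff] at h
  obtain ⟨r, ⟨hr0, hr⟩, hrR⟩ := h
  exact ⟨r, hr0, (ENNReal.ofReal_lt_ofReal_iff_of_nonneg hr0.le).1 hrR, hr⟩

lemma luxNorm_le_ofReal {r : ℝ} (hr : 0 < r)
    (h : ∫⁻ z, ENNReal.ofReal (Φ (‖F z‖ / r)) ∂(V α) ≤ 1) :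
    luxNorm α Φ F ≤ ENNReal.ofReal r := iInf₂_le r ⟨hr, h⟩

lemma mdifferentiable_const_mul (hF : MDifferentiable 𝓘(ℂ) 𝓘(ℂ) F) (c : ℂ) :
    MDifferentiable 𝓘(ℂ) 𝓘(ℂ) fun z => c * F z := by
  rw [UpperHalfPlane.mdifferentiable_iff] at hF ⊢
  exact hF.const_mul c

/-- Pointwise growth of the elements of the unit ball. -/
theorem Regular.exists_map_norm_le (h : Regular Φ a) (α : ℝ) :
    ∃ C : ℝ, 1 ≤ C ∧ ∀ F : ℍ → ℂ, MDifferentiable 𝓘(ℂ) 𝓘(ℂ) F →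
      ∫⁻ z, ENNReal.ofReal (Φ ‖F z‖) ∂(V α) ≤ 1 → ∀ z : ℍ,
      Φ ‖F z‖ ≤ C * (1 / z.im ^ (2 + α)) ∧ ENNReal.ofReal (z.im ^ (2 + α) * Φ ‖F z‖)
        ≤ ENNReal.ofReal C * ∫⁻ w in whitneyDisc z, ENNReal.ofReal (Φ ‖F w‖) ∂(V α) := by
  obtain ⟨C, hC0, hC⟩ := h.exists_mul_rpow_le_setLIntegral α
  refine ⟨max C 1, le_max_right _ _, fun F hF hF1 z => ?_⟩
  have hy : 0 < z.im := z.im_pos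
  have h1 := (hC F hF z).trans (mul_le_mul_left (ENNReal.ofReal_le_ofReal (le_max_left C 1)) _)
  refine ⟨?_, h1⟩
  have h2 := h1.trans (mul_le_mul_right ((setLIntegral_le_lintegral _ _).trans hF1) _)
  rw [mul_one, ENNReal.ofReal_le_ofReal_iff (by positivity)] at h2
  rw [mul_one_div, le_div_iff₀ (by positivity), mul_comm]
  exact h2

lemma norm_inv_mul_eq_div {r : ℝ} (hr : 0 < r) (w : ℂ) : ‖((r⁻¹ : ℝ) : ℂ) * w‖ = ‖w‖ / r := by
  rw [norm_mul, Complex.norm_real, Real.norm_of_nonneg (inv_nonneg.2 hr.le), inv_mul_eq_div]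

/-- If the norm were 0, the pointwise bound applied to `F / r` with `r` arbitrarily small would give
`|F(z)| ≤ R T` for every `R > 0`, with `T` depending only on `z`. -/
theorem Regular.luxNorm_toReal_pos (h : Regular Φ a) (hF : F ∈ bergmanOrlicz α Φ) (hF0 : F ≠ 0) :
    0 < (luxNorm α Φ F).toReal := by
  by_contra hcon
  have hN : luxNorm α Φ F = 0 := by
    have := le_antisymm (not_lt.1 hcon) ENNReal.toReal_nonneg
    rw [ENNReal.toReal_eq_zero_iff] at this
    exact this.resolve_right hF.2.ne
  obtain ⟨C, hC1, hC⟩ := h.exists_map_norm_le α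
  refine hF0 (funext fun z => ?_)
  have hy : 0 < z.im := z.im_pos
  set T := inv Φ (C * (1 / z.im ^ (2 + α))) with hT
  have hu : 0 < C * (1 / z.im ^ (2 + α)) := by positivity
  have hTp : 0 < T := h.inv_pos hu
  have hbd : ∀ R : ℝ, 0 < R → ‖F z‖ ≤ R * T := by
    intro R hR
    obtain ⟨r, hr0, hrR, hr⟩ := exists_lintegral_le_one_of_luxNorm_lt (R := R)
      (by rw [hN]; exact ENNReal.ofReal_pos.2 hR)
    have h1 := (hC (fun z => ((r⁻¹ : ℝ) : ℂ) * F z) (mdifferentiable_const_mul hF.1 _)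
      (by simpa only [norm_inv_mul_eq_div hr0] using hr) z).1
    rw [norm_inv_mul_eq_div hr0, ← h.le_inv_iff (by positivity) hu.le, div_le_iff₀ hr0,
      mul_comm] at h1
    exact h1.trans (by gcongr)
  have h0 : ‖F z‖ ≤ 0 := by
    refine le_of_forall_pos_le_add fun ε hε => ?_
    have := hbd (ε / T) (by positivity)
    rwa [div_mul_cancel₀ _ hTp.ne', ← zero_add ε] at this
  simpa using h0

end LuxNorm

/-! ### From the Carleson condition to the strong type bound. -/

section Embedding

variable {Φ₁ Φ₂ : ℝ → ℝ} {a b α : ℝ} {μ : Measure ℍ}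

lemma Regular.comp_inv_mono (h₁ : Regular Φ₁ a) (h₂ : Regular Φ₂ b) {u v : ℝ} (hu : 0 ≤ u)
    (huv : u ≤ v) : Φ₂ (inv Φ₁ u) ≤ Φ₂ (inv Φ₁ v) :=
  h₂.mono (h₁.inv_nonneg hu) (h₁.inv_mono hu huv)

lemma Regular.comp_inv_doubling (h₁ : Regular Φ₁ a) (h₂ : Regular Φ₂ b) {K : ℝ} (hK : 1 ≤ K) :
    ∃ C, 0 < C ∧ ∀ u, 0 ≤ u → Φ₂ (inv Φ₁ (K * u)) ≤ C * Φ₂ (inv Φ₁ u) := by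
  have hK0 : 0 < K := by linarith
  obtain ⟨C, hC0, hC⟩ := h₂.doubling (K ^ (1 / a)) (by positivity)
  exact ⟨C, hC0, fun u hu => (h₂.mono (h₁.inv_nonneg (by positivity)) (h₁.inv_mul_le hK hu)).trans
    (hC _ (h₁.inv_nonneg hu))⟩

lemma volume_real_Ioo_sub_add {x r : ℝ} (hr : 0 ≤ r) :
    volume.real (Ioo (x - r) (x + r)) = 2 * r := by
  rw [Real.volume_real_Ioo_of_le (by linarith)]
  ring

lemma measure_carlesonSquare_Ioo_le {s : ℝ} {Θ : ℝ → ℝ} {C : ℝ}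
    (hC : ∀ I : Set ℝ, I.OrdConnected → Bornology.IsBounded I → 0 < volume.real I →
      μ (carlesonSquare I) ≤ ENNReal.ofReal (C / Θ (1 / volume.real I ^ s)))
    (x : ℝ) {r : ℝ} (hr : 0 < r) :
    μ (carlesonSquare (Ioo (x - r) (x + r))) ≤ ENNReal.ofReal (C / Θ (1 / (2 * r) ^ s)) := by
  have := hC (Ioo (x - r) (x + r)) ordConnected_Ioo (Metric.isBounded_Ioo _ _)
    (by rw [volume_real_Ioo_sub_add hr.le]; positivity)
  rwa [volume_real_Ioo_sub_add hr.le] at this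

lemma mem_carlesonSquare_Ioo {x r : ℝ} (hr : 0 ≤ r) {z : ℍ} :
    z ∈ carlesonSquare (Ioo (x - r) (x + r)) ↔ |z.re - x| < r ∧ z.im < 2 * r := by
  rw [carlesonSquare, mem_ofPred_eq, volume_real_Ioo_sub_add hr, mem_Ioo, abs_lt]
  constructor <;> rintro ⟨⟨h1, h2⟩, h3⟩ <;> exact ⟨⟨by linarith, by linarith⟩, h3⟩

/-- The Carleson squares exhaust the half-plane and have finite mass. This is what permits Tonelli's
theorem for an arbitrary `μ`. -/
lemma IsSCarleson.sigmaFinite {s : ℝ} {Θ : ℝ → ℝ} (h : IsSCarleson s Θ μ) : SigmaFinite μ := by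
  obtain ⟨C, -, hC⟩ := h
  refine ⟨⟨⟨fun n : ℕ => carlesonSquare (Ioo (0 - ((n : ℝ) + 1)) (0 + ((n : ℝ) + 1))),
    fun _ => trivial, fun n => ?_, ?_⟩⟩⟩
  · exact (measure_carlesonSquare_Ioo_le hC 0 (by positivity)).trans_lt ENNReal.ofReal_lt_top
  · refine eq_univ_of_forall fun z => mem_iUnion.2 ?_
    obtain ⟨n, hn⟩ := exists_nat_gt (max |z.re| z.im)
    have h1 := (le_max_left _ _).trans_lt hn
    have h2 := (le_max_right _ _).trans_lt hn
    refine ⟨n, (mem_carlesonSquare_Ioo (by positivity)).2 ⟨?_, ?_⟩⟩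
    · rw [sub_zero]; linarith
    · have : (0 : ℝ) ≤ n := n.cast_nonneg
      linarith

lemma measurable_comp_inv (h₁ : Regular Φ₁ a) (h₂ : Regular Φ₂ b) (s : ℝ) :
    Measurable fun z : ℍ => Φ₂ (inv Φ₁ (1 / z.im ^ s)) := by
  -- Monotonicity already gives measurability, so continuity of the inverse is not needed.
  have hmono : Monotone fun u : ℝ => Φ₂ (inv Φ₁ (max u 0)) := fun u v huv =>
    h₁.comp_inv_mono h₂ (le_max_right _ _) (max_le_max_right _ huv)
  have him : Measurable UpperHalfPlane.im := UpperHalfPlane.continuous_im.measurable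
  have h3 : Measurable fun z : ℍ => 1 / z.im ^ s := by fun_prop
  convert hmono.measurable.comp h3 using 2 with z
  have : 0 ≤ 1 / z.im ^ s := by have := z.im_pos; positivity
  simp only [Function.comp, max_eq_left this]

theorem IsCarleson.exists_lintegral_le (h₁ : Regular Φ₁ a) (h₂ : Regular Φ₂ b) (hα : -1 < α)
    (hmono : MonotoneOn (fun t => Φ₂ t / Φ₁ t) (Ioi 0))
    (hμ : IsCarleson α (Φ₂ ∘ inv Φ₁) μ) :
    ∃ C : ℝ, 0 < C ∧ ∀ F : ℍ → ℂ, MDifferentiable 𝓘(ℂ) 𝓘(ℂ) F →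
      ∫⁻ z, ENNReal.ofReal (Φ₁ ‖F z‖) ∂(V α) ≤ 1 →
      ∫⁻ z, ENNReal.ofReal (Φ₂ ‖F z‖) ∂μ ≤ ENNReal.ofReal C := by
  have hσ : SigmaFinite μ := IsSCarleson.sigmaFinite hμ
  have hV : SFinite (V α) := by unfold V; infer_instance
  obtain ⟨A, hA0, hA⟩ := hμ
  obtain ⟨K, hK1, hK⟩ := h₁.exists_map_norm_le α
  have hK0 : 0 < K := by linarith
  obtain ⟨D, hD0, hD⟩ := h₁.comp_inv_doubling h₂ hK1
  have hs : 0 < 2 + α := by linarith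
  -- The factor 3 compares heights: `w` in the Whitney disc of `z` has `2 Im w < 3 Im z`.
  obtain ⟨E, hE0, hE⟩ := h₁.comp_inv_doubling h₂ (Real.one_le_rpow (by norm_num : (1:ℝ) ≤ 3) hs.le)
  refine ⟨D * (E * A), by positivity, fun F hF hF1 => ?_⟩
  set g : ℍ → ℝ≥0∞ := fun w => ENNReal.ofReal (Φ₁ ‖F w‖) with hg
  have hgm : Measurable g :=
    (h₁.measurable_comp (measurable_of_mdifferentiable hF).norm
      fun _ => norm_nonneg _).ennreal_ofReal
  set Θ : ℍ → ℝ := fun z => Φ₂ (inv Φ₁ (1 / z.im ^ (2 + α))) with hΘ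
  have hΘm : Measurable Θ := measurable_comp_inv h₁ h₂ _
  have hWm : ∀ z, MeasurableSet (whitneyDisc z) := fun z =>
    UpperHalfPlane.measurable_coe measurableSet_ball
  set P : Set (ℍ × ℍ) := {p | p.2 ∈ whitneyDisc p.1} with hP
  have hPm : MeasurableSet P := by
    have him := UpperHalfPlane.continuous_im
    have hcoe := UpperHalfPlane.continuous_coe
    have : IsOpen P := isOpen_lt (f := fun p : ℍ × ℍ => dist (p.2 : ℂ) p.1)
      (g := fun p : ℍ × ℍ => p.1.im / 2) (by fun_prop) (by fun_prop)
    exact this.measurableSet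
  have hpt : ∀ z, ENNReal.ofReal (Φ₂ ‖F z‖) ≤ ENNReal.ofReal D * ∫⁻ w,
      ENNReal.ofReal (Θ z) * P.indicator (fun p => g p.2) (z, w) ∂(V α) := by
    intro z
    have hy : 0 < z.im := z.im_pos
    obtain ⟨h3, h4⟩ := hK F hF hF1 z
    have hu : 0 < 1 / z.im ^ (2 + α) := by positivity
    have hΘ0 : 0 ≤ Θ z := h₂.nonneg (h₁.inv_nonneg hu.le)
    -- Monotonicity of `Φ₂ / Φ₁` is used here, between `|F(z)|` and its pointwise bound; doubling
    -- then removes `K` from the argument.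
    have hreal : Φ₂ ‖F z‖ ≤ D / K * Θ z * (z.im ^ (2 + α) * Φ₁ ‖F z‖) := by
      rcases (norm_nonneg (F z)).eq_or_lt with h0 | h0
      · rw [← h0, h₁.growth.map_zero, h₂.growth.map_zero]
        simp
      have hT : ‖F z‖ ≤ inv Φ₁ (K * (1 / z.im ^ (2 + α))) :=
        (h₁.le_inv_iff h0.le (by positivity)).2 h3
      have h5 := hmono (mem_Ioi.2 h0) (mem_Ioi.2 (h0.trans_le hT)) hT
      simp only [h₁.map_inv (by positivity : 0 ≤ K * (1 / z.im ^ (2 + α)))] at h5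
      have hp := h₁.pos _ h0
      rw [div_le_iff₀ hp] at h5
      refine h5.trans ?_
      have h6 := hD _ hu.le
      calc _ ≤ D * Θ z / (K * (1 / z.im ^ (2 + α))) * Φ₁ ‖F z‖ := by gcongr
        _ = _ := by field_simp
    calc ENNReal.ofReal (Φ₂ ‖F z‖)
        ≤ ENNReal.ofReal (D / K) * ENNReal.ofReal (Θ z) *
            ENNReal.ofReal (z.im ^ (2 + α) * Φ₁ ‖F z‖) := by
          rw [← ENNReal.ofReal_mul (by positivity), ← ENNReal.ofReal_mul (by positivity)]
          exact ENNReal.ofReal_le_ofReal hreal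
      _ ≤ ENNReal.ofReal (D / K) * ENNReal.ofReal (Θ z) *
            (ENNReal.ofReal K * ∫⁻ w in whitneyDisc z, g w ∂(V α)) := by gcongr
      _ = ENNReal.ofReal D * (ENNReal.ofReal (Θ z) * ∫⁻ w in whitneyDisc z, g w ∂(V α)) := by
          rw [show D = D / K * K by field_simp, ENNReal.ofReal_mul (p := D / K) (by positivity),
            div_mul_cancel₀ _ hK0.ne']
          ring
      _ = _ := by
          rw [← lintegral_indicator (hWm z), lintegral_const_mul' _ _ ENNReal.ofReal_ne_top]
          rfl
  have hinner : ∀ w, ∫⁻ z, ENNReal.ofReal (Θ z) * P.indicator (fun p => g p.2) (z, w) ∂μ ≤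
      ENNReal.ofReal (E * A) * g w := by
    intro w
    have hv : 0 < w.im := w.im_pos
    -- `Q` contains every `z` whose Whitney disc contains `w`: then `Im z < 2 Im w` and `|Re z - Re
    -- w| < Im z / 2 < Im w`.
    set Q := carlesonSquare (Ioo (w.re - w.im) (w.re + w.im)) with hQ
    set q := Φ₂ (inv Φ₁ (1 / (2 * w.im) ^ (2 + α))) with hq
    have hq0 : 0 < q := h₂.pos _ (h₁.inv_pos (by positivity))
    have hQm : MeasurableSet Q := by
      have : Q = {z : ℍ | |z.re - w.re| < w.im} ∩ {z : ℍ | z.im < 2 * w.im} := by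
        ext z; exact mem_carlesonSquare_Ioo hv.le
      rw [this]
      have hre := UpperHalfPlane.continuous_re
      have him := UpperHalfPlane.continuous_im
      exact ((isOpen_lt (by fun_prop) (by fun_prop)).inter
        (isOpen_lt (by fun_prop) (by fun_prop))).measurableSet
    calc ∫⁻ z, ENNReal.ofReal (Θ z) * P.indicator (fun p => g p.2) (z, w) ∂μ
        ≤ ∫⁻ z, Q.indicator (fun _ => ENNReal.ofReal (E * q) * g w) z ∂μ := by
          refine lintegral_mono fun z => ?_
          by_cases hz : (z, w) ∈ P
          · obtain ⟨h3, h4, h5⟩ := im_bounds_of_mem_whitneyDisc hz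
            have hy := z.im_pos
            have hzQ : z ∈ Q :=
              (mem_carlesonSquare_Ioo hv.le).2 ⟨by linarith, by linarith⟩
            rw [indicator_of_mem hz, indicator_of_mem hzQ]
            gcongr
            refine (h₁.comp_inv_mono h₂ (by positivity) ?_).trans (hE _ (by positivity))
            rw [mul_one_div, div_le_div_iff₀ (by positivity) (by positivity), one_mul,
              ← Real.mul_rpow (by norm_num) hy.le]
            exact Real.rpow_le_rpow (by positivity) (by linarith) hs.le
          · rw [indicator_of_notMem hz, mul_zero]
            exact zero_le
      _ = ENNReal.ofReal (E * q) * g w * μ Q := by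
          rw [lintegral_indicator hQm, setLIntegral_const]
      _ ≤ ENNReal.ofReal (E * q) * g w * ENNReal.ofReal (A / q) := by
          gcongr
          exact measure_carlesonSquare_Ioo_le hA w.re hv
      _ = _ := by
          rw [mul_right_comm, ← ENNReal.ofReal_mul (by positivity)]
          congr 2
          field_simp
  calc ∫⁻ z, ENNReal.ofReal (Φ₂ ‖F z‖) ∂μ
      ≤ ∫⁻ z, ENNReal.ofReal D * ∫⁻ w,
          ENNReal.ofReal (Θ z) * P.indicator (fun p => g p.2) (z, w) ∂(V α) ∂μ :=
        lintegral_mono hpt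
    _ = ENNReal.ofReal D * ∫⁻ w, ∫⁻ z,
          ENNReal.ofReal (Θ z) * P.indicator (fun p => g p.2) (z, w) ∂μ ∂(V α) := by
        rw [lintegral_const_mul' _ _ ENNReal.ofReal_ne_top, lintegral_lintegral_swap]
        refine Measurable.aemeasurable ?_
        exact (hΘm.comp measurable_fst).ennreal_ofReal.mul
          ((hgm.comp measurable_snd).indicator hPm)
    _ ≤ ENNReal.ofReal D * ∫⁻ w, ENNReal.ofReal (E * A) * g w ∂(V α) := by
        gcongr with w
        exact hinner w
    _ ≤ ENNReal.ofReal D * (ENNReal.ofReal (E * A) * 1) := by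
        rw [lintegral_const_mul' _ _ ENNReal.ofReal_ne_top]
        gcongr
    _ = _ := by rw [mul_one, ← ENNReal.ofReal_mul hD0.le]

/-- The Carleson embedding. -/
theorem IsCarleson.exists_lintegral_div_luxNorm_le (h₁ : Regular Φ₁ a) (h₂ : Regular Φ₂ b)
    (hα : -1 < α) (hmono : MonotoneOn (fun t => Φ₂ t / Φ₁ t) (Ioi 0))
    (hμ : IsCarleson α (Φ₂ ∘ inv Φ₁) μ) :
    ∃ C : ℝ, 0 < C ∧ ∀ F ∈ bergmanOrlicz α Φ₁, F ≠ 0 →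
      ∫⁻ z : ℍ, ENNReal.ofReal (Φ₂ (‖F z‖ / (luxNorm α Φ₁ F).toReal)) ∂μ ≤ ENNReal.ofReal C := by
  obtain ⟨C, hC0, hC⟩ := hμ.exists_lintegral_le h₁ h₂ hα hmono
  obtain ⟨D, hD0, hD⟩ := h₂.doubling 2 two_pos
  refine ⟨D * C, by positivity, fun F hF hF0 => ?_⟩
  have hN := h₁.luxNorm_toReal_pos hF hF0
  set N := (luxNorm α Φ₁ F).toReal with hNdef
  -- Taking an admissible `r < 2 N` avoids asking whether the infimum is attained; doubling of `Φ₂`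
  -- pays for the factor 2.
  obtain ⟨r, hr0, hrN, hr⟩ := exists_lintegral_le_one_of_luxNorm_lt (R := 2 * N) (F := F)
    (Φ := Φ₁) (α := α) (by
      rw [← ENNReal.ofReal_toReal hF.2.ne]
      exact (ENNReal.ofReal_lt_ofReal_iff (by positivity)).2 (by linarith))
  have h3 := hC (fun z => ((r⁻¹ : ℝ) : ℂ) * F z) (mdifferentiable_const_mul hF.1 _)
    (by simpa only [norm_inv_mul_eq_div hr0] using hr)
  simp only [norm_inv_mul_eq_div hr0] at h3
  calc ∫⁻ z : ℍ, ENNReal.ofReal (Φ₂ (‖F z‖ / N)) ∂μ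
      ≤ ∫⁻ z : ℍ, ENNReal.ofReal D * ENNReal.ofReal (Φ₂ (‖F z‖ / r)) ∂μ := by
        refine lintegral_mono fun z => ?_
        rw [← ENNReal.ofReal_mul hD0.le]
        apply ENNReal.ofReal_le_ofReal
        refine (h₂.mono (by positivity) ?_).trans (hD _ (by positivity))
        rw [mul_div_assoc', div_le_div_iff₀ hN hr0]
        nlinarith [norm_nonneg (F z)]
    _ ≤ _ := by
        rw [lintegral_const_mul' _ _ ENNReal.ofReal_ne_top, ENNReal.ofReal_mul hD0.le]
        gcongr

end Embedding

/-! ### The kernel, its integral, and the test functions. -/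

section Kernel

variable (w z : ℍ)

lemma re_sub_star : ((w : ℂ) - star (z : ℂ)).re = w.re - z.re := by simp

lemma im_sub_star : ((w : ℂ) - star (z : ℂ)).im = w.im + z.im := by simp

lemma im_add_im_le_norm_sub_star : w.im + z.im ≤ ‖(w : ℂ) - star (z : ℂ)‖ := by
  rw [← im_sub_star]
  exact (le_abs_self _).trans (Complex.abs_im_le_norm _)

lemma abs_re_sub_re_le_norm_sub_star : |w.re - z.re| ≤ ‖(w : ℂ) - star (z : ℂ)‖ := by
  rw [← re_sub_star]
  exact Complex.abs_re_le_norm _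

lemma norm_sub_star_le : ‖(w : ℂ) - star (z : ℂ)‖ ≤ |w.re - z.re| + (w.im + z.im) := by
  refine (Complex.norm_le_abs_re_add_abs_im _).trans_eq ?_
  rw [re_sub_star, im_sub_star, abs_of_pos (add_pos w.im_pos z.im_pos)]

lemma norm_sub_star_pos : 0 < ‖(w : ℂ) - star (z : ℂ)‖ :=
  (add_pos w.im_pos z.im_pos).trans_le (im_add_im_le_norm_sub_star w z)

end Kernel

lemma lintegral_rpow_Ioo {α L : ℝ} (hα : -1 < α) (hL : 0 ≤ L) :
    ∫⁻ v in Ioo 0 L, ENNReal.ofReal (v ^ α) = ENNReal.ofReal (L ^ (α + 1) / (α + 1)) := by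
  rw [← ofReal_integral_eq_lintegral_ofReal, ← integral_Ioc_eq_integral_Ioo,
    ← intervalIntegral.integral_of_le hL, integral_rpow (Or.inl hα),
    Real.zero_rpow (by linarith), sub_zero]
  · have := intervalIntegral.intervalIntegrable_rpow' (a := 0) (b := L) hα
    rw [intervalIntegrable_iff_integrableOn_Ioc_of_le hL] at this
    exact this.mono_set Ioo_subset_Ioc_self
  · exact (ae_restrict_mem measurableSet_Ioo).mono fun v hv => Real.rpow_nonneg hv.1.le _

lemma measurableSet_carlesonSquare {I : Set ℝ} (hI : MeasurableSet I) :
    MeasurableSet (carlesonSquare I) := by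
  have hre := UpperHalfPlane.continuous_re.measurable
  have him := UpperHalfPlane.continuous_im.measurable
  exact (hre hI).inter (measurableSet_lt him measurable_const)

lemma V_carlesonSquare_Ioo {α : ℝ} (hα : -1 < α) (x : ℝ) {r : ℝ} (hr : 0 < r) :
    V α (carlesonSquare (Ioo (x - r) (x + r))) =
      ENNReal.ofReal ((2 * r) ^ (2 + α) / (α + 1)) := by
  set I := Ioo (x - r) (x + r) with hI
  set J := Ioo 0 (2 * r) with hJ
  have hpre : carlesonSquare I = UpperHalfPlane.coe ⁻¹' (I ×ℂ J) := by
    ext w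
    simp only [hI, mem_preimage, Complex.mem_reProdIm, UpperHalfPlane.coe_re,
      UpperHalfPlane.coe_im, carlesonSquare, volume_real_Ioo_sub_add hr.le, hJ, mem_ofPred_eq]
    exact and_congr_right fun _ => ⟨fun h => ⟨w.im_pos, h⟩, fun h => h.2⟩
  have h2 : I ×ℂ J = Complex.measurableEquivRealProd ⁻¹' (I ×ˢ J) := by
    ext w; simp [Complex.mem_reProdIm]
  have hm : MeasurableSet (I ×ℂ J) := by
    rw [h2]
    exact Complex.measurableEquivRealProd.measurable (measurableSet_Ioo.prod measurableSet_Ioo)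
  rw [← setLIntegral_one, setLIntegral_V α (measurableSet_carlesonSquare measurableSet_Ioo) _
    measurable_const, hpre]
  have h1 := setLIntegral_comap_coe hm (fun w hw => hw.2.1)
    (fun w => ENNReal.ofReal (w.im ^ α))
  simp only [UpperHalfPlane.coe_im] at h1
  simp only [mul_one]
  rw [h1]
  have hmp := Complex.volume_preserving_equiv_real_prod
  have h3 := hmp.setLIntegral_comp_preimage_emb Complex.measurableEquivRealProd.measurableEmbedding
    (fun p : ℝ × ℝ => ENNReal.ofReal (p.2 ^ α)) (I ×ˢ J)
  simp only [Complex.measurableEquivRealProd_apply] at h3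
  rw [h2, h3, Measure.volume_eq_prod, ← Measure.prod_restrict, lintegral_prod _ (by fun_prop)]
  simp only [lintegral_rpow_Ioo hα (by positivity : 0 ≤ 2 * r), hJ, lintegral_const]
  rw [Measure.restrict_apply_univ, hI, Real.volume_Ioo, ← ENNReal.ofReal_mul
    (div_nonneg (by positivity) (by linarith))]
  congr 1
  rw [show 2 + α = α + 1 + 1 by ring, Real.rpow_add_one (by positivity) (α + 1)]
  ring

lemma exists_mem_carlesonSquare_and_le_norm (w z : ℍ) :
    ∃ k : ℕ, w ∈ carlesonSquare (Ioo (z.re - 2 ^ k * z.im) (z.re + 2 ^ k * z.im)) ∧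
      2 ^ k * z.im ≤ 2 * ‖(w : ℂ) - star (z : ℂ)‖ := by
  classical
  have hy := z.im_pos
  have hex : ∃ k : ℕ, w ∈ carlesonSquare (Ioo (z.re - 2 ^ k * z.im) (z.re + 2 ^ k * z.im)) := by
    obtain ⟨k, hk⟩ := pow_unbounded_of_one_lt (max (|w.re - z.re| / z.im) (w.im / z.im))
      (one_lt_two : (1 : ℝ) < 2)
    have h1 := (le_max_left _ _).trans_lt hk
    have h2 := (le_max_right _ _).trans_lt hk
    rw [div_lt_iff₀ hy] at h1 h2
    refine ⟨k, (mem_carlesonSquare_Ioo (by positivity)).2 ⟨h1, h2.trans ?_⟩⟩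
    have : 0 < 2 ^ k * z.im := by positivity
    linarith
  -- For the least such `k`, failure at `k - 1` makes the horizontal distance at least `2 ^ (k - 1)
  -- Im z` or the height at least `2 ^ k Im z`; for `k = 0` the norm already exceeds `Im z`.
  refine ⟨Nat.find hex, Nat.find_spec hex, ?_⟩
  have hge := im_add_im_le_norm_sub_star w z
  have hre := abs_re_sub_re_le_norm_sub_star w z
  have hw := w.im_pos
  rcases hk : Nat.find hex with _ | k
  · rw [pow_zero, one_mul]
    linarith
  · have hnot := Nat.find_min hex (m := k) (by omega)
    rw [mem_carlesonSquare_Ioo (by positivity), not_and_or, not_lt, not_lt] at hnot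
    rw [pow_succ]
    have : 0 < 2 ^ k * z.im := by positivity
    rcases hnot with h | h <;> linarith

/-- Dyadic squares about `z`: with `q = 2 ^ (2 + α)`, the kernel power at step `k` is at most `q ^ 2
/ q ^ (2 k)` and the square has measure `q ^ (k + 1) y ^ (2 + α) / (α + 1)`, which leaves a
geometric series of ratio `q⁻¹`. -/
theorem exists_lintegral_kernel_le {α : ℝ} (hα : -1 < α) :
    ∃ C : ℝ, 0 < C ∧ ∀ z : ℍ,
      ∫⁻ w : ℍ, ENNReal.ofReal ((z.im / ‖(w : ℂ) - star (z : ℂ)‖) ^ (4 + 2 * α)) ∂(V α)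
        ≤ ENNReal.ofReal (C * z.im ^ (2 + α)) := by
  have hs : 0 < 2 + α := by linarith
  set q : ℝ := 2 ^ (2 + α) with hq
  have hq1 : 1 < q := Real.one_lt_rpow one_lt_two hs
  have hq0 : 0 < q := by linarith
  have hα1 : 0 < α + 1 := by linarith
  refine ⟨q ^ 3 / (α + 1) * (1 - q⁻¹)⁻¹,
    mul_pos (by positivity) (inv_pos.2 (sub_pos.2 (inv_lt_one_of_one_lt₀ hq1))), fun z => ?_⟩
  have hy := z.im_pos
  set Q : ℕ → Set ℍ := fun k =>
    carlesonSquare (Ioo (z.re - 2 ^ k * z.im) (z.re + 2 ^ k * z.im)) with hQ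
  have hQm : ∀ k, MeasurableSet (Q k) := fun k => measurableSet_carlesonSquare measurableSet_Ioo
  have hpow : ∀ k : ℕ, ((2 : ℝ) ^ k) ^ (2 + α) = q ^ k := fun k =>
    (Real.rpow_pow_comm two_pos.le _ _).symm
  have hpt : ∀ w : ℍ, ENNReal.ofReal ((z.im / ‖(w : ℂ) - star (z : ℂ)‖) ^ (4 + 2 * α)) ≤
      ∑' k, (Q k).indicator (fun _ => ENNReal.ofReal (q ^ 2 / (q ^ k) ^ 2)) w := by
    intro w
    obtain ⟨k, hk, hk2⟩ := exists_mem_carlesonSquare_and_le_norm w z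
    refine le_trans ?_ (ENNReal.le_tsum k)
    rw [indicator_of_mem hk]
    apply ENNReal.ofReal_le_ofReal
    have hn := norm_sub_star_pos w z
    have h1 : z.im / ‖(w : ℂ) - star (z : ℂ)‖ ≤ 2 / 2 ^ k := by
      rw [div_le_div_iff₀ hn (by positivity)]
      linarith
    calc (z.im / ‖(w : ℂ) - star (z : ℂ)‖) ^ (4 + 2 * α) ≤ (2 / 2 ^ k) ^ (4 + 2 * α) :=
          Real.rpow_le_rpow (by positivity) h1 (by linarith)
      _ = q ^ 2 / (q ^ k) ^ 2 := by
          rw [show 4 + 2 * α = (2 + α) * (2 : ℕ) by push_cast; ring, Real.rpow_mul_natCast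
            (by positivity), Real.div_rpow (by positivity) (by positivity), hpow, div_pow]
  calc _ ≤ ∫⁻ w : ℍ, ∑' k, (Q k).indicator (fun _ => ENNReal.ofReal (q ^ 2 / (q ^ k) ^ 2)) w
        ∂(V α) := lintegral_mono hpt
    _ = ∑' k, ENNReal.ofReal (q ^ 3 / (α + 1) * z.im ^ (2 + α) * q⁻¹ ^ k) := by
        rw [lintegral_tsum fun k => (measurable_const.indicator (hQm k)).aemeasurable]
        congr 1
        ext k
        rw [lintegral_indicator (hQm k), setLIntegral_const,
          V_carlesonSquare_Ioo hα _ (by positivity), ← ENNReal.ofReal_mul (by positivity)]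
        congr 1
        rw [Real.mul_rpow two_pos.le (by positivity), Real.mul_rpow (by positivity) hy.le, hpow,
          ← hq, inv_pow]
        field_simp
    _ = ENNReal.ofReal (∑' k, q ^ 3 / (α + 1) * z.im ^ (2 + α) * q⁻¹ ^ k) :=
        (ENNReal.ofReal_tsum_of_nonneg (fun k => by positivity)
          ((summable_geometric_of_lt_one (by positivity)
            (inv_lt_one_of_one_lt₀ hq1)).mul_left _)).symm
    _ = _ := by
        rw [tsum_mul_left, tsum_geometric_of_lt_one (by positivity) (inv_lt_one_of_one_lt₀ hq1)]
        congr 1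
        ring

/-- The factor `-i` turns `w - z̄` into the right half-plane, where the principal power is
holomorphic; a real exponent makes its modulus exact. -/
lemma exists_mdifferentiable_norm_eq (T β : ℝ) (hT : 0 ≤ T) (z : ℍ) :
    ∃ F : ℍ → ℂ, MDifferentiable 𝓘(ℂ) 𝓘(ℂ) F ∧
      ∀ w : ℍ, ‖F w‖ = T * (z.im ^ β / ‖(w : ℂ) - star (z : ℂ)‖ ^ β) := by
  have hy := z.im_pos
  set f : ℂ → ℂ := fun w =>
    ((T * z.im ^ β : ℝ) : ℂ) * (-Complex.I * (w - star (z : ℂ))) ^ ((-β : ℝ) : ℂ) with hf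
  refine ⟨fun w => f w, ?_, fun w => ?_⟩
  · rw [UpperHalfPlane.mdifferentiable_iff]
    have hfd : DifferentiableOn ℂ f {w | 0 < w.im} := by
      intro w hw
      have hw0 : 0 < w.im := hw
      refine DifferentiableAt.differentiableWithinAt ?_
      refine DifferentiableAt.const_mul ?_ _
      refine DifferentiableAt.cpow (by fun_prop) (by fun_prop) (Or.inl ?_)
      simp only [neg_mul, Complex.neg_re, Complex.I_mul_re, Complex.sub_im, neg_neg,
        Complex.star_def, Complex.conj_im, UpperHalfPlane.coe_im]
      linarith
    refine hfd.congr fun w hw => ?_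
    simp only [Function.comp, UpperHalfPlane.ofComplex_apply_of_im_pos hw]
  · have hn := norm_sub_star_pos w z
    rw [hf, norm_mul, Complex.norm_real, Complex.norm_cpow_real, norm_mul (-Complex.I), norm_neg,
      Complex.norm_I, one_mul, Real.norm_of_nonneg (by positivity), Real.rpow_neg hn.le]
    ring

/-- Functions of uniformly bounded norm which are large near a prescribed point. -/
theorem Regular.exists_test_function {Φ : ℝ → ℝ} {a α : ℝ} (h : Regular Φ a) (hα : -1 < α) :
    ∃ R : ℝ, 0 < R ∧ ∀ z : ℍ, ∃ F ∈ bergmanOrlicz α Φ, F ≠ 0 ∧ (luxNorm α Φ F).toReal ≤ R ∧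
      ∀ w : ℍ, ‖F w‖ = inv Φ (1 / z.im ^ (2 + α)) *
        (z.im ^ ((4 + 2 * α) / a) / ‖(w : ℂ) - star (z : ℂ)‖ ^ ((4 + 2 * α) / a)) := by
  have ha := h.index_pos
  obtain ⟨C₀, hC₀, hC⟩ := exists_lintegral_kernel_le hα
  set C := max C₀ 1 with hCdef
  have hC1 : 1 ≤ C := le_max_right _ _
  have hC0 : 0 < C := by linarith
  set R := C ^ (1 / a) with hR
  have hR1 : 1 ≤ R := Real.one_le_rpow hC1 (by positivity)
  have hR0 : 0 < R := by linarith
  refine ⟨R, hR0, fun z => ?_⟩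
  have hy := z.im_pos
  have hu : 0 < 1 / z.im ^ (2 + α) := by positivity
  set T := inv Φ (1 / z.im ^ (2 + α)) with hT
  have hT0 : 0 < T := h.inv_pos hu
  obtain ⟨F, hF, hFn⟩ := exists_mdifferentiable_norm_eq T ((4 + 2 * α) / a) hT0.le z
  have hint : ∫⁻ w, ENNReal.ofReal (Φ (‖F w‖ / R)) ∂(V α) ≤ 1 := by
    calc ∫⁻ w, ENNReal.ofReal (Φ (‖F w‖ / R)) ∂(V α)
        ≤ ∫⁻ w : ℍ, ENNReal.ofReal (1 / z.im ^ (2 + α) / C) *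
          ENNReal.ofReal ((z.im / ‖(w : ℂ) - star (z : ℂ)‖) ^ (4 + 2 * α)) ∂(V α) := by
          refine lintegral_mono fun w => ?_
          have hn := norm_sub_star_pos w z
          have hl : z.im / ‖(w : ℂ) - star (z : ℂ)‖ ≤ 1 := by
            rw [div_le_one hn]
            have := im_add_im_le_norm_sub_star w z
            have := w.im_pos
            linarith
          set l := z.im / ‖(w : ℂ) - star (z : ℂ)‖ with hldef
          have hl0 : 0 < l := by positivity
          have hFl : ‖F w‖ = T * l ^ ((4 + 2 * α) / a) := by
            rw [hFn, hldef, Real.div_rpow hy.le hn.le]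
          rw [← ENNReal.ofReal_mul (by positivity)]
          apply ENNReal.ofReal_le_ofReal
          have hexp : 0 ≤ (4 + 2 * α) / a := div_nonneg (by linarith) ha.le
          -- The exponent is divided by `a` so that `scale` returns `l ^ (4 + 2 α)`, the power whose
          -- integral is known. Likewise `R = C ^ (1 / a)` makes the division by `R` gain the factor
          -- `C⁻¹`.
          have h1 := h.scale (l ^ ((4 + 2 * α) / a)) (by positivity)
            (Real.rpow_le_one hl0.le hl hexp) T hT0.le
          rw [← hFl, ← Real.rpow_mul hl0.le, div_mul_cancel₀ _ ha.ne', h.map_inv hu.le] at h1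
          have h2 := h.scale R⁻¹ (by positivity) (inv_le_one_of_one_le₀ hR1) ‖F w‖
            (norm_nonneg _)
          rw [Real.inv_rpow hR0.le, hR, ← Real.rpow_mul hC0.le, one_div_mul_cancel ha.ne',
            Real.rpow_one, ← hR, ← div_eq_mul_inv] at h2
          refine h2.trans ?_
          calc C⁻¹ * Φ ‖F w‖ ≤ C⁻¹ * (l ^ (4 + 2 * α) * (1 / z.im ^ (2 + α))) := by gcongr
            _ = _ := by ring
      _ ≤ ENNReal.ofReal (1 / z.im ^ (2 + α) / C) * ENNReal.ofReal (C * z.im ^ (2 + α)) := by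
          rw [lintegral_const_mul' _ _ ENNReal.ofReal_ne_top]
          gcongr
          refine (hC z).trans (ENNReal.ofReal_le_ofReal ?_)
          gcongr
          exact le_max_left _ _
      _ = 1 := by
          rw [← ENNReal.ofReal_mul (by positivity), ← ENNReal.ofReal_one]
          congr 1
          field_simp
  have hlux := luxNorm_le_ofReal hR0 hint
  refine ⟨F, ⟨hF, hlux.trans_lt ENNReal.ofReal_lt_top⟩, ?_, ENNReal.toReal_le_of_le_ofReal hR0.le
    hlux, hFn⟩
  rintro rfl
  have h1 := hFn z
  have hn := norm_sub_star_pos z z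
  have : 0 < T * (z.im ^ ((4 + 2 * α) / a) / ‖(z : ℂ) - star (z : ℂ)‖ ^ ((4 + 2 * α) / a)) := by
    positivity
  rw [← h1] at this
  simp at this

/-! ### From the testing, strong and weak type bounds back to the Carleson condition. -/

section Necessity

variable {Φ₁ Φ₂ : ℝ → ℝ} {a b α : ℝ} {μ : Measure ℍ}

/-- Each Carleson square `Q_I` has a point `z` above it, at height `|I|`, for which the kernel is
bounded below on `Q_I`. -/
lemma exists_forall_carlesonSquare_le {I : Set ℝ} (hI : I.OrdConnected)
    (hb : Bornology.IsBounded I) (hI0 : 0 < volume.real I) :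
    ∃ z : ℍ, z.im = volume.real I ∧ ∀ w ∈ carlesonSquare I, ∀ β : ℝ, 0 ≤ β →
      ((3 : ℝ) ^ β)⁻¹ ≤ z.im ^ β / ‖(w : ℂ) - star (z : ℂ)‖ ^ β := by
  obtain ⟨x, hx⟩ : I.Nonempty := by
    rw [nonempty_iff_ne_empty]
    rintro rfl
    simp at hI0
  set L := volume.real I with hL
  refine ⟨⟨⟨x, L⟩, hI0⟩, rfl, fun w hw β hβ => ?_⟩
  set z : ℍ := ⟨⟨x, L⟩, hI0⟩ with hz
  have hzi : z.im = L := rfl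
  have hzr : z.re = x := rfl
  have h1 : |w.re - x| ≤ L := by
    have h2 : volume.real (uIcc x w.re) ≤ L :=
      measureReal_mono (hI.uIcc_subset hx hw.1) hb.measure_lt_top.ne
    rwa [Real.volume_real_interval] at h2
  have hn := norm_sub_star_pos w z
  -- One `L` each for the horizontal distance, the height of `w` and the height of `z`.
  have h3 : ‖(w : ℂ) - star (z : ℂ)‖ ≤ 3 * L := by
    have := norm_sub_star_le w z
    have : w.im < L := hw.2
    rw [hzr, hzi] at *
    linarith
  rw [hzi, ← Real.div_rpow hI0.le hn.le, ← Real.inv_rpow (by norm_num)]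
  refine Real.rpow_le_rpow (by norm_num) ?_ hβ
  rw [le_div_iff₀ hn]
  linarith

lemma le_ofReal_div_of_mul_le {c : ℝ} {m : ℝ≥0∞} {C : ℝ} (hc : 0 < c)
    (h : ENNReal.ofReal c * m ≤ ENNReal.ofReal C) : m ≤ ENNReal.ofReal (C / c) := by
  rw [ENNReal.ofReal_div_of_pos hc, ENNReal.le_div_iff_mul_le
    (Or.inl (by simpa using hc)) (Or.inl ENNReal.ofReal_ne_top), mul_comm]
  exact h

/-- To be a Carleson measure it suffices to bound the mass of `Q_I` by the reciprocal of the value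
of `Φ₂` at a fixed multiple of `Φ₁⁻¹ (1 / |I| ^ (2 + α))`. -/
lemma isCarleson_of_forall_mul_le (h₁ : Regular Φ₁ a) (h₂ : Regular Φ₂ b) {κ C : ℝ} (hκ : 0 < κ)
    (hC : 0 < C)
    (h : ∀ I : Set ℝ, I.OrdConnected → Bornology.IsBounded I → 0 < volume.real I →
      ENNReal.ofReal (Φ₂ (κ * inv Φ₁ (1 / volume.real I ^ (2 + α)))) * μ (carlesonSquare I)
        ≤ ENNReal.ofReal C) :
    IsCarleson α (Φ₂ ∘ inv Φ₁) μ := by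
  obtain ⟨D, hD0, hD⟩ := h₂.doubling κ⁻¹ (by positivity)
  refine ⟨D * C, by positivity, fun I hI hb hI0 => ?_⟩
  have hT : 0 < inv Φ₁ (1 / volume.real I ^ (2 + α)) := h₁.inv_pos (by positivity)
  have hpos := h₂.pos _ (mul_pos hκ hT)
  refine (le_ofReal_div_of_mul_le hpos (h I hI hb hI0)).trans (ENNReal.ofReal_le_ofReal ?_)
  have h3 := hD _ (mul_pos hκ hT).le
  rw [inv_mul_cancel_left₀ hκ.ne'] at h3
  rw [Function.comp, div_le_div_iff₀ hpos (h₂.pos _ hT)]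
  calc C * _ ≤ C * (D * _) := by gcongr
    _ = _ := by ring

/-- Only the lower bound of the kernel on the square enters, so any exponent `β ≥ 0` serves; this
covers both values of `ρ`. -/
theorem isCarleson_of_lintegral_kernel_le (h₁ : Regular Φ₁ a) (h₂ : Regular Φ₂ b) {β C : ℝ}
    (hβ : 0 ≤ β) (hC : 0 < C)
    (h : ∀ z : ℍ, ∫⁻ w : ℍ, ENNReal.ofReal (Φ₂ (inv Φ₁ (1 / z.im ^ (2 + α)) *
      (z.im ^ β / ‖(w : ℂ) - star (z : ℂ)‖ ^ β))) ∂μ ≤ ENNReal.ofReal C) :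
    IsCarleson α (Φ₂ ∘ inv Φ₁) μ := by
  refine isCarleson_of_forall_mul_le h₁ h₂ (κ := ((3 : ℝ) ^ β)⁻¹) (by positivity) hC
    fun I hI hb hI0 => ?_
  obtain ⟨z, hz, hzI⟩ := exists_forall_carlesonSquare_le hI hb hI0
  rw [← hz]
  have hy := z.im_pos
  have hT := h₁.inv_pos (u := 1 / z.im ^ (2 + α)) (by positivity)
  rw [← setLIntegral_const]
  refine le_trans ?_ ((setLIntegral_le_lintegral (carlesonSquare I) _).trans (h z))
  refine setLIntegral_mono' (measurableSet_carlesonSquare hI.measurableSet) fun w hw => ?_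
  apply ENNReal.ofReal_le_ofReal
  rw [mul_comm]
  exact h₂.mono (by positivity) (by gcongr; exact hzI w hw β hβ)

theorem exists_lintegral_kernel_comp_le (h₁ : Regular Φ₁ a) (h₂ : Regular Φ₂ b) (hα : -1 < α)
    {C : ℝ} (hC : 0 < C)
    (h : ∀ F ∈ bergmanOrlicz α Φ₁, F ≠ 0 →
      ∫⁻ z : ℍ, ENNReal.ofReal (Φ₂ (‖F z‖ / (luxNorm α Φ₁ F).toReal)) ∂μ ≤ ENNReal.ofReal C) :
    ∃ C : ℝ, 0 < C ∧ ∀ z : ℍ, ∫⁻ w : ℍ, ENNReal.ofReal (Φ₂ (inv Φ₁ (1 / z.im ^ (2 + α)) *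
      (z.im ^ ((4 + 2 * α) / a) / ‖(w : ℂ) - star (z : ℂ)‖ ^ ((4 + 2 * α) / a)))) ∂μ
        ≤ ENNReal.ofReal C := by
  obtain ⟨R, hR0, hR⟩ := h₁.exists_test_function hα
  obtain ⟨D, hD0, hD⟩ := h₂.doubling R hR0
  refine ⟨D * C, by positivity, fun z => ?_⟩
  obtain ⟨F, hF, hF0, hFR, hFn⟩ := hR z
  have hN := h₁.luxNorm_toReal_pos hF hF0
  simp only [← hFn]
  calc ∫⁻ w, ENNReal.ofReal (Φ₂ ‖F w‖) ∂μ
      ≤ ∫⁻ w, ENNReal.ofReal D * ENNReal.ofReal (Φ₂ (‖F w‖ / (luxNorm α Φ₁ F).toReal)) ∂μ := by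
        refine lintegral_mono fun w => ?_
        rw [← ENNReal.ofReal_mul hD0.le]
        apply ENNReal.ofReal_le_ofReal
        refine (h₂.mono (norm_nonneg _) ?_).trans (hD _ (by positivity))
        rw [mul_div_assoc', le_div_iff₀ hN, mul_comm]
        gcongr
    _ ≤ _ := by
        rw [lintegral_const_mul' _ _ ENNReal.ofReal_ne_top, ENNReal.ofReal_mul hD0.le]
        gcongr
        exact h F hF hF0

/-- Chebyshev's inequality: the strong type bound implies the weak type bound. -/
theorem iSup_mul_measure_le (h₁ : Regular Φ₁ a) (h₂ : Regular Φ₂ b) {C : ℝ}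
    (h : ∀ F ∈ bergmanOrlicz α Φ₁, F ≠ 0 →
      ∫⁻ z : ℍ, ENNReal.ofReal (Φ₂ (‖F z‖ / (luxNorm α Φ₁ F).toReal)) ∂μ ≤ ENNReal.ofReal C)
    {F : ℍ → ℂ} (hF : F ∈ bergmanOrlicz α Φ₁) :
    (⨆ (l : ℝ) (_ : 0 < l), ENNReal.ofReal (Φ₂ l) *
      μ {z : ℍ | l * (luxNorm α Φ₁ F).toReal < ‖F z‖}) ≤ ENNReal.ofReal C := by
  refine iSup₂_le fun l hl => ?_
  rcases eq_or_ne F 0 with rfl | hF0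
  · have : {z : ℍ | l * (luxNorm α Φ₁ 0).toReal < ‖(0 : ℍ → ℂ) z‖} = ∅ := by
      refine eq_empty_of_forall_notMem fun z hz => ?_
      rw [mem_ofPred_eq, Pi.zero_apply, norm_zero] at hz
      exact hz.not_ge (by positivity)
    rw [this, measure_empty, mul_zero]
    exact zero_le
  · have hN := h₁.luxNorm_toReal_pos hF hF0
    refine le_trans ?_ (h F hF hF0)
    rw [← setLIntegral_const]
    refine le_trans ?_ (setLIntegral_le_lintegral
      {z : ℍ | l * (luxNorm α Φ₁ F).toReal < ‖F z‖} _)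
    refine setLIntegral_mono' (measurableSet_lt measurable_const
      (measurable_of_mdifferentiable hF.1).norm) fun z hz => ?_
    apply ENNReal.ofReal_le_ofReal
    exact h₂.mono hl.le ((le_div_iff₀ hN).2 (le_of_lt hz))

theorem isCarleson_of_iSup_mul_measure_le (h₁ : Regular Φ₁ a) (h₂ : Regular Φ₂ b) (hα : -1 < α)
    {C : ℝ} (hC : 0 < C)
    (h : ∀ F ∈ bergmanOrlicz α Φ₁,
      (⨆ (l : ℝ) (_ : 0 < l), ENNReal.ofReal (Φ₂ l) *
        μ {z : ℍ | l * (luxNorm α Φ₁ F).toReal < ‖F z‖}) ≤ ENNReal.ofReal C) :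
    IsCarleson α (Φ₂ ∘ inv Φ₁) μ := by
  obtain ⟨R, hR0, hR⟩ := h₁.exists_test_function hα
  have ha := h₁.index_pos
  set β := (4 + 2 * α) / a with hβdef
  have hβ : 0 ≤ β := div_nonneg (by linarith) ha.le
  -- The level is `κ T`: `3 ^ (-β)` is the lower bound of the kernel on the square, `R` bounds the
  -- norm of the test function, and the 2 makes the inequality strict, as the superlevel set
  -- requires.
  refine isCarleson_of_forall_mul_le h₁ h₂ (κ := ((3 : ℝ) ^ β)⁻¹ / (2 * R)) (by positivity) hC
    fun I hI hb hI0 => ?_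
  obtain ⟨z, hz, hzI⟩ := exists_forall_carlesonSquare_le hI hb hI0
  rw [← hz]
  obtain ⟨F, hF, hF0, hFR, hFn⟩ := hR z
  have hy := z.im_pos
  have hT := h₁.inv_pos (u := 1 / z.im ^ (2 + α)) (by positivity)
  set T := inv Φ₁ (1 / z.im ^ (2 + α)) with hTdef
  set l := ((3 : ℝ) ^ β)⁻¹ / (2 * R) * T with hl
  have hl0 : 0 < l := by positivity
  refine le_trans ?_ (le_iSup₂ (f := fun (l : ℝ) (_ : 0 < l) => ENNReal.ofReal (Φ₂ l) *
    μ {z : ℍ | l * (luxNorm α Φ₁ F).toReal < ‖F z‖}) l hl0 |>.trans (h F hF))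
  gcongr
  intro w hw
  have h3 := hzI w hw β hβ
  rw [mem_ofPred_eq, hFn]
  calc l * (luxNorm α Φ₁ F).toReal ≤ l * R := by gcongr
    _ = T * ((3 : ℝ) ^ β)⁻¹ / 2 := by rw [hl]; field_simp
    _ < T * ((3 : ℝ) ^ β)⁻¹ := half_lt_self (by positivity)
    _ ≤ _ := by gcongr

end Necessity

end BergmanOrlicz

theorem theorem2p3 (α : ℝ) (hα : -1 < α) (Φ₁ Φ₂ : ℝ → ℝ)
    (hΦ₁ : BergmanOrlicz.ClassL Φ₁ ∨ BergmanOrlicz.ClassU Φ₁)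
    (hΦ₂ : BergmanOrlicz.ClassL Φ₂ ∨ BergmanOrlicz.ClassU Φ₂)
    (μ : Measure ℍ)
    (hmono : MonotoneOn (fun t => Φ₂ t / Φ₁ t) (Ioi 0)) :
    List.TFAE [
      BergmanOrlicz.IsCarleson α (Φ₂ ∘ BergmanOrlicz.inv Φ₁) μ,
      ∃ ρ ∈ ({1, BergmanOrlicz.lowerIndex Φ₁} : Set ℝ), ∃ C : ℝ, 0 < C ∧ ∀ z : ℍ,
        ∫⁻ w : ℍ, ENNReal.ofReal (Φ₂ (BergmanOrlicz.inv Φ₁ (1 / z.im ^ (2 + α)) *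
          (z.im ^ ((4 + 2 * α) / ρ) / ‖(w : ℂ) - star (z : ℂ)‖ ^ ((4 + 2 * α) / ρ)))) ∂μ
          ≤ ENNReal.ofReal C,
      ∃ C : ℝ, 0 < C ∧ ∀ F ∈ BergmanOrlicz.bergmanOrlicz α Φ₁, F ≠ 0 →
        ∫⁻ z : ℍ, ENNReal.ofReal (Φ₂ (‖F z‖ / (BergmanOrlicz.luxNorm α Φ₁ F).toReal)) ∂μ
          ≤ ENNReal.ofReal C,
      ∃ C : ℝ, 0 < C ∧ ∀ F ∈ BergmanOrlicz.bergmanOrlicz α Φ₁,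
        (⨆ (l : ℝ) (_ : 0 < l), ENNReal.ofReal (Φ₂ l) *
          μ {z : ℍ | l * (BergmanOrlicz.luxNorm α Φ₁ F).toReal < ‖F z‖})
          ≤ ENNReal.ofReal C] := by
  have h₁ := BergmanOrlicz.regular_of_class hΦ₁
  have h₂ := BergmanOrlicz.regular_of_class hΦ₂
  have ha := h₁.index_pos
  tfae_have 1 → 3 := fun h => h.exists_lintegral_div_luxNorm_le h₁ h₂ hα hmono
  -- The test functions produce `ρ` equal to the lower index; the converse accepts any positive `ρ`.
  tfae_have 3 → 2 := fun ⟨C, hC, h⟩ =>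
    ⟨_, Or.inr rfl, BergmanOrlicz.exists_lintegral_kernel_comp_le h₁ h₂ hα hC h⟩
  tfae_have 2 → 1 := by
    rintro ⟨ρ, hρ, C, hC, h⟩
    have hρ0 : 0 < ρ := by
      rcases hρ with rfl | rfl
      · exact one_pos
      · exact ha
    exact BergmanOrlicz.isCarleson_of_lintegral_kernel_le h₁ h₂
      (div_nonneg (by linarith) hρ0.le) hC h
  tfae_have 3 → 4 := fun ⟨C, hC, h⟩ =>
    ⟨C, hC, fun F hF => BergmanOrlicz.iSup_mul_measure_le h₁ h₂ h hF⟩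
  tfae_have 4 → 1 := fun ⟨C, hC, h⟩ =>
    BergmanOrlicz.isCarleson_of_iSup_mul_measure_le h₁ h₂ hα hC h
  tfae_finish
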